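/- Let $\mathbf F$ be a number field with adele ring $\mathbb A$, let $\mathbf K=\prod_v \mathbf K_v\subset \mathrm{GL}_2(\mathbb A)$ be the standard maximal compact subgroup ($\mathbf K_v=\mathrm{SO}_2(\mathbb R)$, $\mathrm{SU}_2(\mathbb C)$, $\mathrm{GL}_2(\mathfrak o_v)$ for $v$ real, complex, finite respectively), let $\mathbf B$ be the group of upper triangular matrices, and write $n(x)=\begin{pmatrix}1&x\\0&1\end{pmatrix}$, $a(y)=\begin{pmatrix}y&0\\0&1\end{pmatrix}$. Let $\omega$ be a unitary character of $\mathbf F^\times\backslash\mathbb A^\times$. A smooth function $\varphi$ on $\mathrm{GL}_2(\mathbf F)\backslash \mathrm{GL}_2(\mathbb A)$ with central character $\omega$ is called finitely regularizable if there are finitely many unitary characters $\chi_i$ of $\mathbf F^\times\backslash\mathbb A^\times$, numbers $\alpha_i\in\mathbb C$, $n_i\in\mathbb N$, and smooth functions $f_i\in \mathrm{Ind}_{\mathbf B(\mathbb A)\cap\mathbf K}^{\mathbf K}(\chi_i,\omega\chi_i^{-1})$, $1\le i\le l$ (with $l=0$ allowed), such that for every $M$, uniformly in $x\in\mathbb A$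 and $k\in\mathbf K$, $$\varphi(n(x)a(y)k)=\sum_{i=1}^l\chi_i(y)|y|_{\mathbb A}^{\frac12+\alpha_i}(\log|y|_{\mathbb A})^{n_i}f_i(k)+O(|y|_{\mathbb A}^{-M}),\qquad |y|_{\mathbb A}\to\infty .$$ (Smooth means: right invariant under an open subgroup of the finite-adelic component of the group, and $C^\infty$ in the archimedean component.) Denote the space of such functions by $\mathcal A^{\mathrm{fr}}(\mathrm{GL}_2,\omega)$. The exponent set $\mathcal E\mathrm x(\varphi)$ of $\varphi$ is the set of quasi-characters $\chi_i|\cdot|_{\mathbb A}^{1/2+\alpha_i}$ that occur in such an expansion once it is reduced, i.e. the pairs $(\chi_i|\cdot|_{\mathbb A}^{1/2+\alpha_i},n_i)$ are pairwise distinct and all $f_i$ are non-zero. Then $\mathcal A^{\mathrm{fr}}(\mathrm{GL}_2,\omega)$ is stable under right translation by $\mathrm{GL}_2(\mathbb A)$: for $\varphi\in\mathcal A^{\mathrm{fr}}(\mathrm{GL}_2,\omega)$ and $g\in\mathrm{GL}_2(\mathbb A)$, the function $g.\varphi\colon x\mapsto\varphi(xg)$ lies in $\mathcal A^{\mathrm{fr}}(\mathrm{GL}_2,\omega)$.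 Moreover, for all such $\varphi$ and $g$, $$\mathcal E\mathrm x(g.\varphi)=\mathcal E\mathrm x(\varphi).$$ -/

import Mathlib

open NumberField IsDedekindDomain
open scoped NumberField.AdeleRing MatrixGroups

noncomputable section

namespace FinReg

/-! ## Ideles, the adelic norm, Hecke characters -/

section Ideles

variable (K : Type*) [Field K] [NumberField K]

/-- The adelic norm `|y|_𝔸 = ∏_v |y_v|_v` of an idele: the archimedean part is the product of the
normalized absolute values (the square of the usual one at complex places), the finite part the
product of the normalized absolute values, almost all of which are `1`. -/
def ideleNorm (y : 𝔸[K]ˣ) : ℝ :=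
  ‖(y : 𝔸[K]).1‖ * ∏ᶠ v : HeightOneSpectrum (𝓞 K), ‖(y : 𝔸[K]).2 v‖

/-- A unitary character of `Kˣ \ 𝔸ˣ`: a continuous homomorphism from the ideles to the unit circle
that is trivial on principal ideles. -/
structure HeckeCharacter where
  /-- The underlying continuous character of the idele group. -/
  toHom : 𝔸[K]ˣ →ₜ* Circle
  map_principal : ∀ x : Kˣ, toHom (Units.map (algebraMap K 𝔸[K]).toMonoidHom x) = 1

end Ideles

variable {K : Type*} [Field K] [NumberField K]

instance : CoeFun (HeckeCharacter K) (fun _ => 𝔸[K]ˣ → Circle) := ⟨fun χ => χ.toHom⟩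

/-- The quasi-character `y ↦ χ(y) |y|_𝔸 ^ s` of the idele group, as a function. -/
def quasiCharacter (χ : HeckeCharacter K) (s : ℂ) (y : 𝔸[K]ˣ) : ℂ :=
  (χ y : ℂ) * (ideleNorm K y : ℂ) ^ s

/-! ## Elements and subgroups of `GL₂(𝔸)` -/

/-- The upper triangular matrix `(t₁, x; 0, t₂)`. -/
def borel {R : Type*} [CommRing R] (t₁ : Rˣ) (x : R) (t₂ : Rˣ) : GL (Fin 2) R where
  val := !![(t₁ : R), x; 0, (t₂ : R)]
  inv := !![(↑t₁⁻¹ : R), -(↑t₁⁻¹ * x * ↑t₂⁻¹); 0, (↑t₂⁻¹ : R)]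
  val_inv := by
    ext i j; fin_cases i <;> fin_cases j <;> simp [Matrix.mul_apply, Fin.sum_univ_two, mul_assoc]
  inv_val := by
    ext i j; fin_cases i <;> fin_cases j <;> simp [Matrix.mul_apply, Fin.sum_univ_two, mul_assoc]

/-- `z(u)`. -/
def zMat {R : Type*} [CommRing R] (u : Rˣ) : GL (Fin 2) R := borel u 0 u

/-- `n(x)`. -/
def nMat {R : Type*} [CommRing R] (x : R) : GL (Fin 2) R := borel 1 x 1

/-- `a(y)`. -/
def aMat {R : Type*} [CommRing R] (y : Rˣ) : GL (Fin 2) R := borel y 0 1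

/-- The projection `GL₂(𝔸) → GL₂(K_∞)`. -/
def glInf : GL (Fin 2) 𝔸[K] →* GL (Fin 2) K∞ :=
  Matrix.GeneralLinearGroup.map (RingHom.fst K∞ 𝔸ᶠ[K])

/-- The projection `GL₂(𝔸) → GL₂(𝔸_f)`. -/
def glFin : GL (Fin 2) 𝔸[K] →* GL (Fin 2) 𝔸ᶠ[K] :=
  Matrix.GeneralLinearGroup.map (RingHom.snd K∞ 𝔸ᶠ[K])

/-- The matrix of an element of `GL₂(K_∞)`, with entries in `ℝ^{r₁} × ℂ^{r₂}` by the standard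
identifications of the archimedean completions with `ℝ` and `ℂ`. -/
def infMatrix (h : GL (Fin 2) K∞) : Fin 2 → Fin 2 → mixedEmbedding.mixedSpace K :=
  fun i j => InfiniteAdeleRing.ringEquiv_mixedSpace K (h.val i j)

/-- `K_∞`, the product of `SO₂(ℝ)` over the real places and of `SU₂(ℂ)` over the complex ones:
the special unitary matrices over `ℝ^{r₁} × ℂ^{r₂}` with its coordinatewise conjugation. -/
def maxCompactInf (K : Type*) [Field K] [NumberField K] : Subgroup (GL (Fin 2) K∞) :=
  (Matrix.specialUnitaryGroup (Fin 2) (mixedEmbedding.mixedSpace K)).units.comap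
    (Matrix.GeneralLinearGroup.map (InfiniteAdeleRing.ringEquiv_mixedSpace K).toRingHom)

/-- The ring `∏_v 𝓞_v` of integral finite adeles. -/
def integralFiniteAdeles (K : Type*) [Field K] [NumberField K] : Subring 𝔸ᶠ[K] where
  carrier := {x | ∀ v : HeightOneSpectrum (𝓞 K), x v ∈ v.adicCompletionIntegers K}
  mul_mem' ha hb v := mul_mem (ha v) (hb v)
  one_mem' v := one_mem (v.adicCompletionIntegers K)
  add_mem' ha hb v := add_mem (ha v) (hb v)
  zero_mem' v := zero_mem (v.adicCompletionIntegers K)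
  neg_mem' ha v := neg_mem (ha v)

/-- `K_f = ∏_v GL₂(𝓞_v)`: the matrices that are integral together with their inverse. -/
def maxCompactFin (K : Type*) [Field K] [NumberField K] : Subgroup (GL (Fin 2) 𝔸ᶠ[K]) :=
  ((integralFiniteAdeles K).matrix (n := Fin 2)).toSubmonoid.units

/-- The standard maximal compact subgroup `𝐊 = K_∞ × K_f` of `GL₂(𝔸)`. -/
def maxCompact (K : Type*) [Field K] [NumberField K] : Subgroup (GL (Fin 2) 𝔸[K]) :=
  (maxCompactInf K).comap glInf ⊓ (maxCompactFin K).comap glFin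

/-! ## Smooth functions -/

open scoped Classical in
/-- A function on `GL₂(𝔸)` is smooth if it is right invariant under an open subgroup of `GL₂(𝔸_f)`
and if, the finite component being fixed, it is a `C^∞` function of the archimedean component,
which runs through the open set of invertible matrices over `ℝ^{r₁} × ℂ^{r₂}`. -/
def IsSmooth (φ : GL (Fin 2) 𝔸[K] → ℂ) : Prop :=
  (∃ U : Subgroup (GL (Fin 2) 𝔸ᶠ[K]), IsOpen (U : Set (GL (Fin 2) 𝔸ᶠ[K])) ∧
    ∀ g g' : GL (Fin 2) 𝔸[K], glInf g' = glInf g → (glFin g)⁻¹ * glFin g' ∈ U → φ g' = φ g) ∧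
  ∀ g₀ : GL (Fin 2) 𝔸[K], ∃ F : (Fin 2 → Fin 2 → mixedEmbedding.mixedSpace K) → ℂ,
    ContDiffOn ℝ ((⊤ : ℕ∞) : WithTop ℕ∞) F {m | IsUnit (Matrix.of m)} ∧
    ∀ g : GL (Fin 2) 𝔸[K], glFin g = glFin g₀ → φ g = F (infMatrix (glInf g))

open scoped Classical in
/-- A function on `𝐊` is smooth if it is right invariant under an open subgroup of `K_f` (the trace
on `K_f` of an open subgroup of `GL₂(𝔸_f)`) and if, the finite component being fixed, it is a `C^∞`
function on the compact Lie group `K_∞`, that is, the restriction to `K_∞` of a `C^∞` function on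
an open neighbourhood of `K_∞` in the real vector space of matrices over `ℝ^{r₁} × ℂ^{r₂}`. -/
def IsSmoothOnCompact (f : maxCompact K → ℂ) : Prop :=
  (∃ U : Subgroup (GL (Fin 2) 𝔸ᶠ[K]), IsOpen (U : Set (GL (Fin 2) 𝔸ᶠ[K])) ∧
    ∀ k k' : maxCompact K, glInf k'.1 = glInf k.1 → (glFin k.1)⁻¹ * glFin k'.1 ∈ U →
      f k' = f k) ∧
  ∀ k₀ : maxCompact K, ∃ (Ω : Set (Fin 2 → Fin 2 → mixedEmbedding.mixedSpace K))
    (F : (Fin 2 → Fin 2 → mixedEmbedding.mixedSpace K) → ℂ),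
    IsOpen Ω ∧ (∀ h ∈ maxCompactInf K, infMatrix h ∈ Ω) ∧
    ContDiffOn ℝ ((⊤ : ℕ∞) : WithTop ℕ∞) F Ω ∧
    ∀ k : maxCompact K, glFin k.1 = glFin k₀.1 → f k = F (infMatrix (glInf k.1))

/-- `f` lies in `Ind_{B(𝔸) ∩ 𝐊}^𝐊 (χ, ω χ⁻¹)`:
`f((t₁, x; 0, t₂) k) = χ(t₁) ω(t₂) χ(t₂)⁻¹ f(k)` for `(t₁, x; 0, t₂) ∈ B(𝔸) ∩ 𝐊`, `k ∈ 𝐊`. -/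
def IsInduced (ω χ : HeckeCharacter K) (f : maxCompact K → ℂ) : Prop :=
  ∀ (t₁ t₂ : 𝔸[K]ˣ) (x : 𝔸[K]) (hb : borel t₁ x t₂ ∈ maxCompact K) (k : maxCompact K),
    f (⟨borel t₁ x t₂, hb⟩ * k) = (χ t₁ : ℂ) * ((ω t₂ : ℂ) * (χ t₂ : ℂ)⁻¹) * f k

/-! ## Finitely regularizable functions -/

/-- The data `(χ, α, n, f)` of one summand
`χ(y) |y|_𝔸^{1/2 + α} log^n |y|_𝔸 f(k)` of an essential constant term. -/
structure ExpTerm (ω : HeckeCharacter K) where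
  /-- the unitary character -/
  χ : HeckeCharacter K
  /-- the complex exponent -/
  α : ℂ
  /-- the power of the logarithm -/
  n : ℕ
  /-- the smooth function on the maximal compact subgroup -/
  f : maxCompact K → ℂ
  smooth : IsSmoothOnCompact f
  induced : IsInduced ω χ f

namespace ExpTerm

variable {ω : HeckeCharacter K}

/-- The exponent `χ |·|_𝔸^{1/2 + α}` of a summand. -/
def exponent (e : ExpTerm ω) : 𝔸[K]ˣ → ℂ := quasiCharacter e.χ (1 / 2 + e.α)

/-- The value of a summand at `n(x) a(y) k`. -/
def value (e : ExpTerm ω) (y : 𝔸[K]ˣ) (k : maxCompact K) : ℂ :=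
  e.exponent y * (Real.log (ideleNorm K y) : ℂ) ^ e.n * e.f k

end ExpTerm

/-- `∑ i, e i` is an essential constant term of `φ`: for every `M`, as `|y|_𝔸 → ∞`,
`φ(n(x) a(y) k) = ∑ i, χ_i(y) |y|_𝔸^{1/2 + α_i} log^{n_i} |y|_𝔸 f_i(k) + O(|y|_𝔸^{-M})`,
uniformly in `x ∈ 𝔸`, `k ∈ 𝐊`. -/
def IsExpansion {ω : HeckeCharacter K} (φ : GL (Fin 2) 𝔸[K] → ℂ) {l : ℕ}
    (e : Fin l → ExpTerm ω) : Prop :=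
  ∀ M : ℝ, ∃ C T : ℝ, ∀ (x : 𝔸[K]) (y : 𝔸[K]ˣ) (k : maxCompact K), T ≤ ideleNorm K y →
    ‖φ (nMat x * aMat y * k.1) - ∑ i, (e i).value y k‖ ≤ C * ideleNorm K y ^ (-M)

/-- An expansion is reduced if like terms have been collected and no term is zero: the pairs
(exponent, power of the logarithm) are pairwise distinct, and all `f_i` are non-zero. -/
def IsReduced {ω : HeckeCharacter K} {l : ℕ} (e : Fin l → ExpTerm ω) : Prop :=
  Function.Injective (fun i => ((e i).exponent, (e i).n)) ∧ ∀ i, (e i).f ≠ 0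

/-- `φ` is a finitely regularizable function with central character `ω`. -/
structure IsFinReg (ω : HeckeCharacter K) (φ : GL (Fin 2) 𝔸[K] → ℂ) : Prop where
  smooth : IsSmooth φ
  left_invariant : ∀ (γ : GL (Fin 2) K) (g : GL (Fin 2) 𝔸[K]),
    φ (Matrix.GeneralLinearGroup.map (algebraMap K 𝔸[K]) γ * g) = φ g
  central : ∀ (u : 𝔸[K]ˣ) (g : GL (Fin 2) 𝔸[K]), φ (zMat u * g) = (ω u : ℂ) * φ g
  expansion : ∃ (l : ℕ) (e : Fin l → ExpTerm ω), IsExpansion φ e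

/-- The exponent set of `φ`: the quasi-characters `χ_i |·|_𝔸^{1/2 + α_i}` that occur in the
essential constant term of `φ`, written in reduced form. (The functions `μ(y) log^n |y|_𝔸`, for
distinct pairs `(μ, n)`, are linearly independent modulo functions that are `O(|y|_𝔸^{-M})` for all
`M`, so the reduced form is unique up to the order of its summands.) -/
def exponentSet (ω : HeckeCharacter K) (φ : GL (Fin 2) 𝔸[K] → ℂ) : Set (𝔸[K]ˣ → ℂ) :=
  {μ | ∃ (l : ℕ) (e : Fin l → ExpTerm ω), IsExpansion φ e ∧ IsReduced e ∧
    ∃ i, μ = (e i).exponent}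

open scoped Classical in
theorem IsSmooth.zero : IsSmooth (0 : GL (Fin 2) 𝔸[K] → ℂ) :=
  ⟨⟨⊤, by simp, fun _ _ _ _ => rfl⟩, fun _ => ⟨0, contDiffOn_const, fun _ _ => rfl⟩⟩

open scoped Classical in
theorem IsSmooth.add {φ ψ : GL (Fin 2) 𝔸[K] → ℂ} (hφ : IsSmooth φ) (hψ : IsSmooth ψ) :
    IsSmooth (φ + ψ) := by
  obtain ⟨⟨U, hU, h1⟩, h2⟩ := hφ
  obtain ⟨⟨V, hV, h3⟩, h4⟩ := hψ
  refine ⟨⟨U ⊓ V, hU.inter hV, fun g g' hg hg' => ?_⟩, fun g₀ => ?_⟩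
  · simp only [Pi.add_apply, h1 g g' hg hg'.1, h3 g g' hg hg'.2]
  · obtain ⟨F, hF, hF'⟩ := h2 g₀
    obtain ⟨G, hG, hG'⟩ := h4 g₀
    exact ⟨F + G, hF.add hG, fun g hg => by simp only [Pi.add_apply, hF' g hg, hG' g hg]⟩

open scoped Classical in
theorem IsSmooth.smul {φ : GL (Fin 2) 𝔸[K] → ℂ} (c : ℂ) (hφ : IsSmooth φ) :
    IsSmooth (c • φ) := by
  obtain ⟨⟨U, hU, h1⟩, h2⟩ := hφ
  refine ⟨⟨U, hU, fun g g' hg hg' => ?_⟩, fun g₀ => ?_⟩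
  · simp only [Pi.smul_apply, h1 g g' hg hg']
  · obtain ⟨F, hF, hF'⟩ := h2 g₀
    exact ⟨c • F, contDiffOn_const.smul hF, fun g hg => by simp only [Pi.smul_apply, hF' g hg]⟩

open scoped Classical in
theorem IsSmoothOnCompact.smul {f : maxCompact K → ℂ} (c : ℂ) (hf : IsSmoothOnCompact f) :
    IsSmoothOnCompact (c • f) := by
  obtain ⟨⟨U, hU, h1⟩, h2⟩ := hf
  refine ⟨⟨U, hU, fun g g' hg hg' => ?_⟩, fun g₀ => ?_⟩
  · simp only [Pi.smul_apply, h1 g g' hg hg']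
  · obtain ⟨Ω, F, hΩ, hΩ', hF, hF'⟩ := h2 g₀
    exact ⟨Ω, c • F, hΩ, hΩ', contDiffOn_const.smul hF,
      fun g hg => by simp only [Pi.smul_apply, hF' g hg]⟩

/-- The summand multiplied by a constant. -/
def ExpTerm.smul {ω : HeckeCharacter K} (c : ℂ) (e : ExpTerm ω) : ExpTerm ω where
  χ := e.χ
  α := e.α
  n := e.n
  f := c • e.f
  smooth := e.smooth.smul c
  induced := fun t₁ t₂ x hb k => by
    simp only [Pi.smul_apply, e.induced t₁ t₂ x hb k, smul_eq_mul]
    ring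

/-- The space `𝒜^{fr}(GL₂, ω)` of finitely regularizable functions with central character `ω`. -/
def finRegSpace (ω : HeckeCharacter K) : Submodule ℂ (GL (Fin 2) 𝔸[K] → ℂ) where
  carrier := {φ | IsFinReg ω φ}
  zero_mem' :=
    { smooth := IsSmooth.zero
      left_invariant := fun _ _ => rfl
      central := fun _ _ => by simp
      expansion := ⟨0, Fin.elim0, fun _ => ⟨0, 0, fun _ _ _ _ => by simp⟩⟩ }
  add_mem' := by
    intro φ ψ hφ hψ
    refine ⟨hφ.smooth.add hψ.smooth, fun γ g => ?_, fun u g => ?_, ?_⟩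
    · simp only [Pi.add_apply, hφ.left_invariant, hψ.left_invariant]
    · simp only [Pi.add_apply, hφ.central, hψ.central, mul_add]
    · obtain ⟨l, e, he⟩ := hφ.expansion
      obtain ⟨m, d, hd⟩ := hψ.expansion
      refine ⟨l + m, Fin.append e d, fun M => ?_⟩
      obtain ⟨C, T, h⟩ := he M
      obtain ⟨C', T', h'⟩ := hd M
      refine ⟨C + C', max T T', fun x y k hy => ?_⟩
      have h1 := h x y k (le_trans (le_max_left _ _) hy)
      have h2 := h' x y k (le_trans (le_max_right _ _) hy)
      rw [Fin.sum_univ_add]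
      simp only [Fin.append_left, Fin.append_right, Pi.add_apply]
      rw [add_sub_add_comm, add_mul]
      exact (norm_add_le _ _).trans (add_le_add h1 h2)
  smul_mem' := by
    intro c φ hφ
    refine ⟨hφ.smooth.smul c, fun γ g => ?_, fun u g => ?_, ?_⟩
    · simp only [Pi.smul_apply, hφ.left_invariant]
    · simp only [Pi.smul_apply, hφ.central, smul_eq_mul]
      ring
    · obtain ⟨l, e, he⟩ := hφ.expansion
      refine ⟨l, fun i => (e i).smul c, fun M => ?_⟩
      obtain ⟨C, T, h⟩ := he M
      refine ⟨‖c‖ * C, T, fun x y k hy => ?_⟩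
      have h1 : ∑ i, ((e i).smul c).value y k = c * ∑ i, (e i).value y k := by
        rw [Finset.mul_sum]
        refine Finset.sum_congr rfl fun i _ => ?_
        simp only [ExpTerm.value, ExpTerm.exponent, ExpTerm.smul, Pi.smul_apply, smul_eq_mul]
        ring
      rw [h1, Pi.smul_apply, smul_eq_mul, ← mul_sub, norm_mul]
      refine le_of_le_of_eq ?_ (mul_assoc _ _ _).symm
      exact mul_le_mul_of_nonneg_left (h x y k hy) (norm_nonneg c)

/-- Right translation: `(g.φ)(x) = φ(x g)`. -/
def rightTranslate (g : GL (Fin 2) 𝔸[K]) (φ : GL (Fin 2) 𝔸[K] → ℂ) : GL (Fin 2) 𝔸[K] → ℂ :=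
  fun x => φ (x * g)

end FinReg

end

noncomputable section

namespace FinReg

/-! ## Upper triangular matrices -/

section Borel

variable {R : Type*} [CommRing R]

/-! The proof rests on the Iwasawa decomposition. Write `k g = (t₁, z; 0, t₂) q` with `q` in `𝐊`,
and put `τ = t₁/t₂`. Then `n(x) a(y) k g = z(t₂) n(x') a(y τ) q`, so the value of `g.φ` at `n(x)
a(y) k` is `ω(t₂)` times the value of `φ` at `n(x') a(y τ) q`. For fixed `g`, `|τ|` stays between
two positive constants as `k` varies (`exists_le_ideleNorm_div`, `exists_ideleNorm_div_le`), so the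
error `O(|y|^{-M})` survives, uniformly in `x` and `k`.

In each main term, `(log|y| + log|τ|)^n` is expanded by the binomial theorem
(`ExpTerm.sum_translate_value`). This gives terms with the same exponent and log powers `m ≤ n`,
whose coefficients are functions of `k g` through `ExpTerm.extend`. They do not depend on the chosen
decomposition (`ExpTerm.extend_borel_mul`) and satisfy the induction law. The technical core is
their smoothness on `𝐊` (`ExpTerm.smooth_extend`): the archimedean decomposition is given by
explicit smooth formulas, and a Hecke character, though only assumed continuous, is smooth on
positive archimedean ideles.

For the exponents, collect like terms (`IsExpansionOn.exists_isReduced`). For each exponent the term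
with the highest log power has a nonzero translate that nothing cancels, so `exponentSet ω φ` is
contained in that of `g.φ`. Applying this to `g.φ` and `g⁻¹` gives the other inclusion. Uniqueness
of the reduced expansion is not needed. -/

theorem borel_mul (t₁ t₂ s₁ s₂ : Rˣ) (x y : R) :
    borel t₁ x t₂ * borel s₁ y s₂ = borel (t₁ * s₁) (t₁ * y + x * s₂) (t₂ * s₂) := by
  ext i j
  fin_cases i <;> fin_cases j <;>
    simp [borel, Matrix.mul_apply, Fin.sum_univ_two]

theorem borel_inv (t₁ t₂ : Rˣ) (x : R) :
    (borel t₁ x t₂)⁻¹ = borel t₁⁻¹ (-(↑t₁⁻¹ * x * ↑t₂⁻¹)) t₂⁻¹ := by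
  ext i j
  fin_cases i <;> fin_cases j <;> rfl

/-- The centre absorbs `t₂` and `y` is scaled by `t₁/t₂`. The new unipotent entry is harmless
because expansions are uniform in `x`. -/
theorem nMat_mul_aMat_mul_borel (x z : R) (y t₁ t₂ : Rˣ) :
    nMat x * aMat y * borel t₁ z t₂ =
      zMat t₂ * (nMat ((y * z + x * t₂) * ↑t₂⁻¹) * aMat (y * (t₁ * t₂⁻¹))) := by
  simp only [nMat, aMat, zMat, borel_mul]
  congr 1
  · ext; simp [mul_comm, mul_left_comm]
  · have h : (t₂ : R) * ↑t₂⁻¹ = 1 := t₂.mul_inv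
    simp only [Units.val_one, Units.val_mul]
    linear_combination (-(y : R) * z - x * t₂) * h
  · simp

theorem det_borel (t₁ t₂ : Rˣ) (x : R) :
    Matrix.GeneralLinearGroup.det (borel t₁ x t₂) = t₁ * t₂ := by
  ext
  simp [borel, Matrix.det_fin_two]

theorem borel_val_one_one (t₁ t₂ : Rˣ) (x : R) : (borel t₁ x t₂).val 1 1 = t₂ := rfl

theorem exists_eq_borel (h : GL (Fin 2) R) (h10 : h.val 1 0 = 0) :
    ∃ (t₁ t₂ : Rˣ) (x : R), h = borel t₁ x t₂ := by
  have hd : IsUnit (h.val 0 0 * h.val 1 1) := by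
    have := (Matrix.isUnit_iff_isUnit_det _).1 h.isUnit
    rwa [Matrix.det_fin_two, h10, mul_zero, sub_zero] at this
  obtain ⟨⟨a, ha⟩, ⟨d, hd⟩⟩ := IsUnit.mul_iff.1 hd
  refine ⟨a, d, h.val 0 1, ?_⟩
  ext i j
  fin_cases i <;> fin_cases j <;> simp [borel, ha, hd, h10]

/-- The invertible matrix `(a, b; c, d)` of determinant one. -/
def slMat (a b c d : R) (h : a * d - b * c = 1) : GL (Fin 2) R where
  val := !![a, b; c, d]
  inv := !![d, -b; -c, a]
  val_inv := by
    ext i j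
    fin_cases i <;> fin_cases j <;> simp [Matrix.mul_apply, Fin.sum_univ_two] <;>
      first | linear_combination h | linear_combination
  inv_val := by
    ext i j
    fin_cases i <;> fin_cases j <;> simp [Matrix.mul_apply, Fin.sum_univ_two] <;>
      first | linear_combination h | linear_combination

theorem mul_slMat_inv_val_one_zero (h : GL (Fin 2) R) (a b c d : R) (H : a * d - b * c = 1) :
    (h * (slMat a b c d H)⁻¹).val 1 0 = h.val 1 0 * d - h.val 1 1 * c := by
  change (h.val * !![d, -b; -c, a]) 1 0 = _
  simp [Matrix.mul_apply, Fin.sum_univ_two, sub_eq_add_neg]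

theorem mul_slMat_inv_val_one_one (h : GL (Fin 2) R) (a b c d : R) (H : a * d - b * c = 1) :
    (h * (slMat a b c d H)⁻¹).val 1 1 = h.val 1 1 * a - h.val 1 0 * b := by
  change (h.val * !![d, -b; -c, a]) 1 1 = _
  simp [Matrix.mul_apply, Fin.sum_univ_two]
  ring

end Borel

/-! ## Local components and the idele norm -/

section IdeleNorm

variable {K : Type*} [Field K] [NumberField K]

/-- The component of an adele at an infinite place. -/
def infAt (w : InfinitePlace K) : 𝔸[K] →+* w.Completion :=
  (Pi.evalRingHom (fun w : InfinitePlace K => w.Completion) w).comp (RingHom.fst K∞ 𝔸ᶠ[K])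

/-- The component of an adele at a finite place. -/
def finAt (v : HeightOneSpectrum (𝓞 K)) : 𝔸[K] →+* v.adicCompletion K where
  toFun x := x.2 v
  map_one' := rfl
  map_mul' _ _ := rfl
  map_zero' := rfl
  map_add' _ _ := rfl

theorem ideleNorm_eq (y : 𝔸[K]ˣ) :
    ideleNorm K y = (∏ w, ‖infAt w (y : 𝔸[K])‖ ^ w.mult) * ∏ᶠ v, ‖finAt v (y : 𝔸[K])‖ := rfl

theorem norm_le_one_iff_mem_integers {v : HeightOneSpectrum (𝓞 K)} {x : v.adicCompletion K} :
    ‖x‖ ≤ 1 ↔ x ∈ v.adicCompletionIntegers K :=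
  Valued.toNormedField.norm_le_one_iff

theorem finite_one_lt_norm_finAt (x : 𝔸[K]) : {v | 1 < ‖finAt v x‖}.Finite := by
  refine Set.Finite.subset (Filter.eventually_cofinite.1 x.2.2) fun v hv => ?_
  simp only [Set.mem_ofPred_eq] at hv ⊢
  exact fun h => absurd (norm_le_one_iff_mem_integers.2 h) (not_le.2 hv)

theorem norm_finAt_mul_inv (y : 𝔸[K]ˣ) (v : HeightOneSpectrum (𝓞 K)) :
    ‖finAt v (y : 𝔸[K])‖ * ‖finAt v (↑y⁻¹ : 𝔸[K])‖ = 1 := by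
  rw [← norm_mul, ← map_mul, Units.mul_inv, map_one, norm_one]

theorem norm_infAt_mul_inv (y : 𝔸[K]ˣ) (w : InfinitePlace K) :
    ‖infAt w (y : 𝔸[K])‖ * ‖infAt w (↑y⁻¹ : 𝔸[K])‖ = 1 := by
  rw [← norm_mul, ← map_mul, Units.mul_inv, map_one, norm_one]

theorem norm_finAt_pos (y : 𝔸[K]ˣ) (v : HeightOneSpectrum (𝓞 K)) :
    0 < ‖finAt v (y : 𝔸[K])‖ :=
  (norm_nonneg _).lt_of_ne' (left_ne_zero_of_mul_eq_one (norm_finAt_mul_inv y v))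

theorem norm_infAt_pos (y : 𝔸[K]ˣ) (w : InfinitePlace K) :
    0 < ‖infAt w (y : 𝔸[K])‖ :=
  (norm_nonneg _).lt_of_ne' (left_ne_zero_of_mul_eq_one (norm_infAt_mul_inv y w))

/-- Where the norm is not `1`, either `y` or `y⁻¹` has norm greater than `1`, and each is an adele.
-/
theorem hasFiniteMulSupport_norm_finAt (y : 𝔸[K]ˣ) :
    Function.HasFiniteMulSupport fun v => ‖finAt v (y : 𝔸[K])‖ := by
  refine ((finite_one_lt_norm_finAt (y : 𝔸[K])).union
    (finite_one_lt_norm_finAt (↑y⁻¹ : 𝔸[K]))).subset fun v hv => ?_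
  rcases lt_or_gt_of_ne (show ‖finAt v (y : 𝔸[K])‖ ≠ 1 from hv) with h | h
  · right
    by_contra h'
    have h' : ‖finAt v (↑y⁻¹ : 𝔸[K])‖ ≤ 1 := not_lt.1 h'
    nlinarith [norm_finAt_mul_inv y v, norm_finAt_pos y v]
  · exact Or.inl h

theorem ideleNorm_pos (y : 𝔸[K]ˣ) : 0 < ideleNorm K y := by
  rw [ideleNorm_eq]
  refine mul_pos (Finset.prod_pos fun w _ => pow_pos (norm_infAt_pos y w) _) ?_
  exact finprod_induction (fun x : ℝ => 0 < x) one_pos (fun _ _ => mul_pos) (norm_finAt_pos y)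

theorem ideleNorm_mul (y z : 𝔸[K]ˣ) : ideleNorm K (y * z) = ideleNorm K y * ideleNorm K z := by
  simp only [ideleNorm_eq, Units.val_mul, map_mul, norm_mul, mul_pow, Finset.prod_mul_distrib]
  rw [finprod_mul_distrib (hasFiniteMulSupport_norm_finAt y) (hasFiniteMulSupport_norm_finAt z)]
  ring

theorem ideleNorm_one : ideleNorm K (1 : 𝔸[K]ˣ) = 1 := by
  simp [ideleNorm_eq]

theorem ideleNorm_inv (y : 𝔸[K]ˣ) : ideleNorm K y⁻¹ = (ideleNorm K y)⁻¹ :=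
  eq_inv_of_mul_eq_one_left (by rw [← ideleNorm_mul, inv_mul_cancel, ideleNorm_one])

theorem ideleNorm_le_of_le {A : InfinitePlace K → ℝ} {N : HeightOneSpectrum (𝓞 K) → ℝ}
    (hN : Function.HasFiniteMulSupport N) (y : 𝔸[K]ˣ)
    (hyA : ∀ w, ‖infAt w (y : 𝔸[K])‖ ≤ A w) (hyN : ∀ v, ‖finAt v (y : 𝔸[K])‖ ≤ N v) :
    ideleNorm K y ≤ (∏ w, A w ^ w.mult) * ∏ᶠ v, N v := by
  rw [ideleNorm_eq]
  refine mul_le_mul ?_ ?_ (finprod_nonneg fun v => norm_nonneg _)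
    (Finset.prod_nonneg fun w _ => pow_nonneg ((norm_nonneg _).trans (hyA w)) _)
  · exact Finset.prod_le_prod (fun w _ => by positivity)
      fun w _ => pow_le_pow_left₀ (norm_nonneg _) (hyA w) _
  · exact finprod_le_finprod (hasFiniteMulSupport_norm_finAt y) (fun v => norm_nonneg _) hN hyN

end IdeleNorm

end FinReg

namespace FinReg

/-! ## The archimedean components -/

section

variable {K : Type*} [Field K]

open scoped Classical in
/-- The component of an element of `ℝ^{r₁} × ℂ^{r₂}` at an infinite place, as a complex number. -/
def mixedAt (w : InfinitePlace K) : mixedEmbedding.mixedSpace K →+* ℂ :=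
  if h : w.IsReal then
    Complex.ofRealHom.comp ((Pi.evalRingHom (fun _ => ℝ) ⟨w, h⟩).comp (RingHom.fst _ _))
  else
    (Pi.evalRingHom (fun _ => ℂ) ⟨w, InfinitePlace.not_isReal_iff_isComplex.1 h⟩).comp
      (RingHom.snd _ _)

theorem mixedAt_of_isReal {w : InfinitePlace K} (h : w.IsReal)
    (x : mixedEmbedding.mixedSpace K) : mixedAt w x = x.1 ⟨w, h⟩ := by
  simp [mixedAt, h]

theorem mixedAt_of_isComplex {w : InfinitePlace K} (h : w.IsComplex)
    (x : mixedEmbedding.mixedSpace K) : mixedAt w x = x.2 ⟨w, h⟩ := by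
  simp [mixedAt, InfinitePlace.not_isReal_iff_isComplex.2 h]

/-- Reduces identities in `ℝ^{r₁} × ℂ^{r₂}` to identities in `ℂ`, treating real and complex places
alike. -/
theorem mixedAt_ext {x y : mixedEmbedding.mixedSpace K} (h : ∀ w, mixedAt w x = mixedAt w y) :
    x = y := by
  refine Prod.ext (funext fun w => ?_) (funext fun w => ?_)
  · have := h w.1
    rwa [mixedAt_of_isReal w.2, mixedAt_of_isReal w.2, Complex.ofReal_inj] at this
  · have := h w.1
    rwa [mixedAt_of_isComplex w.2, mixedAt_of_isComplex w.2] at this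

theorem mixedAt_star (w : InfinitePlace K) (x : mixedEmbedding.mixedSpace K) :
    mixedAt w (star x) = star (mixedAt w x) := by
  rcases w.isReal_or_isComplex with h | h
  · rw [mixedAt_of_isReal h, mixedAt_of_isReal h]
    simp
  · rw [mixedAt_of_isComplex h, mixedAt_of_isComplex h]
    rfl

theorem mixedAt_ringEquiv (w : InfinitePlace K) (x : K∞) :
    mixedAt w (InfiniteAdeleRing.ringEquiv_mixedSpace K x) =
      InfinitePlace.Completion.extensionEmbedding w (x w) := by
  rcases w.isReal_or_isComplex with h | h
  · rw [mixedAt_of_isReal h, InfiniteAdeleRing.ringEquiv_mixedSpace_apply]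
    exact InfinitePlace.Completion.extensionEmbeddingOfIsReal_apply h (x w)
  · rw [mixedAt_of_isComplex h, InfiniteAdeleRing.ringEquiv_mixedSpace_apply]

theorem norm_mixedAt_ringEquiv (w : InfinitePlace K) (x : K∞) :
    ‖mixedAt w (InfiniteAdeleRing.ringEquiv_mixedSpace K x)‖ = ‖x w‖ := by
  rw [mixedAt_ringEquiv]
  exact (InfinitePlace.Completion.isometry_extensionEmbedding w).norm_map_of_map_zero
    (map_zero _) _

/-- The element of `ℝ^{r₁} × ℂ^{r₂}` with given real components. -/
def ofRealFun (x : InfinitePlace K → ℝ) : mixedEmbedding.mixedSpace K :=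
  (fun w => x w.1, fun w => (x w.1 : ℂ))

@[simp]
theorem mixedAt_ofRealFun (w : InfinitePlace K) (x : InfinitePlace K → ℝ) :
    mixedAt w (ofRealFun x) = x w := by
  rcases w.isReal_or_isComplex with h | h
  · rw [mixedAt_of_isReal h]; rfl
  · rw [mixedAt_of_isComplex h]; rfl

end

variable {K : Type*} [Field K] [NumberField K]

/-! ## Elements of the maximal compact subgroup -/

/-- The element of `GL₂(𝔸)` with given archimedean and finite components. -/
def glMk (a : GL (Fin 2) K∞) (b : GL (Fin 2) 𝔸ᶠ[K]) : GL (Fin 2) 𝔸[K] where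
  val := Matrix.of fun i j => (a.val i j, b.val i j)
  inv := Matrix.of fun i j => (a.inv i j, b.inv i j)
  val_inv := by
    ext i j
    refine Prod.ext ?_ ?_
    · have := congr_fun (congr_fun a.val_inv i) j
      rw [Matrix.mul_apply, Fin.sum_univ_two] at this ⊢
      refine Eq.trans this ?_
      fin_cases i <;> fin_cases j <;> rfl
    · have := congr_fun (congr_fun b.val_inv i) j
      rw [Matrix.mul_apply, Fin.sum_univ_two] at this ⊢
      refine Eq.trans this ?_
      fin_cases i <;> fin_cases j <;> rfl
  inv_val := by
    ext i j
    refine Prod.ext ?_ ?_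
    · have := congr_fun (congr_fun a.inv_val i) j
      rw [Matrix.mul_apply, Fin.sum_univ_two] at this ⊢
      refine Eq.trans this ?_
      fin_cases i <;> fin_cases j <;> rfl
    · have := congr_fun (congr_fun b.inv_val i) j
      rw [Matrix.mul_apply, Fin.sum_univ_two] at this ⊢
      refine Eq.trans this ?_
      fin_cases i <;> fin_cases j <;> rfl

theorem glInf_glMk (a : GL (Fin 2) K∞) (b : GL (Fin 2) 𝔸ᶠ[K]) : glInf (glMk a b) = a := by
  ext i j
  rfl

theorem glFin_glMk (a : GL (Fin 2) K∞) (b : GL (Fin 2) 𝔸ᶠ[K]) : glFin (glMk a b) = b := by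
  ext i j
  rfl

theorem glInf_val (g : GL (Fin 2) 𝔸[K]) (i j : Fin 2) : (glInf g).val i j = (g.val i j).1 := rfl

theorem glFin_val (g : GL (Fin 2) 𝔸[K]) (i j : Fin 2) : (glFin g).val i j = (g.val i j).2 := rfl

theorem glMk_mem_maxCompact {a : GL (Fin 2) K∞} {b : GL (Fin 2) 𝔸ᶠ[K]}
    (ha : a ∈ maxCompactInf K) (hb : b ∈ maxCompactFin K) : glMk a b ∈ maxCompact K := by
  refine Subgroup.mem_inf.2 ⟨?_, ?_⟩
  · rw [Subgroup.mem_comap, glInf_glMk]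
    exact ha
  · rw [Subgroup.mem_comap, glFin_glMk]
    exact hb

theorem glInf_mem {k : GL (Fin 2) 𝔸[K]} (hk : k ∈ maxCompact K) : glInf k ∈ maxCompactInf K :=
  hk.1

theorem glFin_mem {k : GL (Fin 2) 𝔸[K]} (hk : k ∈ maxCompact K) : glFin k ∈ maxCompactFin K :=
  hk.2

theorem mem_maxCompactFin_iff {h : GL (Fin 2) 𝔸ᶠ[K]} :
    h ∈ maxCompactFin K ↔ (∀ i j, h.val i j ∈ integralFiniteAdeles K) ∧
      ∀ i j, (h⁻¹).val i j ∈ integralFiniteAdeles K := Iff.rfl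

theorem slMat_mem_maxCompactFin {a b c d : 𝔸ᶠ[K]} (h : a * d - b * c = 1)
    (ha : a ∈ integralFiniteAdeles K) (hb : b ∈ integralFiniteAdeles K)
    (hc : c ∈ integralFiniteAdeles K) (hd : d ∈ integralFiniteAdeles K) :
    slMat a b c d h ∈ maxCompactFin K := by
  refine mem_maxCompactFin_iff.2 ⟨fun i j => ?_, fun i j => ?_⟩
  · fin_cases i <;> fin_cases j <;> assumption
  · fin_cases i <;> fin_cases j
    · exact hd
    · exact neg_mem hb
    · exact neg_mem hc
    · exact ha

theorem norm_finAt_maxCompact_le_one {k : GL (Fin 2) 𝔸[K]} (hk : k ∈ maxCompact K)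
    (v : HeightOneSpectrum (𝓞 K)) (i j : Fin 2) : ‖finAt v (k.val i j)‖ ≤ 1 :=
  norm_le_one_iff_mem_integers.2 ((mem_maxCompactFin_iff.1 (glFin_mem hk)).1 i j v)

/-- The definition also asks that the inverse be special unitary; this is automatic, the inverse
being the adjoint. -/
theorem mem_maxCompactInf_iff {h : GL (Fin 2) K∞} :
    h ∈ maxCompactInf K ↔ Matrix.of (infMatrix h) ∈
      Matrix.specialUnitaryGroup (Fin 2) (mixedEmbedding.mixedSpace K) := by
  refine ⟨fun hh => hh.1, fun hh => ⟨hh, ?_⟩⟩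
  set u := Matrix.GeneralLinearGroup.map (InfiniteAdeleRing.ringEquiv_mixedSpace K).toRingHom h
  have hu : u.val ∈ Matrix.specialUnitaryGroup (Fin 2) (mixedEmbedding.mixedSpace K) := hh
  have hinv : (u⁻¹).val = star u.val := by
    rw [Units.inv_eq_of_mul_eq_one_right (Matrix.mem_unitaryGroup_iff.1 hu.1)]
  change (u⁻¹).val ∈ Matrix.specialUnitaryGroup (Fin 2) (mixedEmbedding.mixedSpace K)
  rw [hinv]
  exact (star (⟨u.val, hu⟩ : Matrix.specialUnitaryGroup (Fin 2) _)).2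

theorem norm_infAt_maxCompact_le_one {k : GL (Fin 2) 𝔸[K]} (hk : k ∈ maxCompact K)
    (w : InfinitePlace K) (i j : Fin 2) : ‖infAt w (k.val i j)‖ ≤ 1 := by
  have hU : Matrix.of (infMatrix (glInf k)) ∈
      Matrix.unitaryGroup (Fin 2) (mixedEmbedding.mixedSpace K) :=
    (mem_maxCompactInf_iff.1 (glInf_mem hk)).1
  have h1 : (Matrix.of (infMatrix (glInf k))).map (mixedAt w) ∈ Matrix.unitaryGroup (Fin 2) ℂ := by
    rw [Matrix.mem_unitaryGroup_iff] at hU ⊢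
    have h2 : star ((Matrix.of (infMatrix (glInf k))).map (mixedAt w)) =
        (star (Matrix.of (infMatrix (glInf k)))).map (mixedAt w) := by
      ext i j
      simp [Matrix.star_apply, mixedAt_star]
    rw [h2, ← Matrix.map_mul, hU]
    simp
  have h3 := entry_norm_bound_of_unitary h1 i j
  have h4 := norm_mixedAt_ringEquiv w ((k.val i j).1)
  exact h4 ▸ h3

/-! ## The Iwasawa decomposition -/

/-- Local Iwasawa step: dividing by the larger of `c` and `d` keeps all entries of norm at most `1`.
The last equation says that the lower-left entry vanishes after multiplication by the inverse
matrix. -/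
theorem exists_norm_le_one_det_one {F : Type*} [NormedField F] (c d : F) :
    ∃ a' b' c' d' : F, ‖a'‖ ≤ 1 ∧ ‖b'‖ ≤ 1 ∧ ‖c'‖ ≤ 1 ∧ ‖d'‖ ≤ 1 ∧ a' * d' - b' * c' = 1 ∧
      c * d' - d * c' = 0 := by
  rcases le_or_gt ‖c‖ ‖d‖ with h | h
  · refine ⟨1, 0, c / d, 1, by simp, by simp, ?_, by simp, by simp, ?_⟩
    · rw [norm_div]
      exact div_le_one_of_le₀ h (norm_nonneg _)
    -- If `d = 0` then `c = 0` by the inequality, and the junk value `c / 0` does no harm.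
    · rcases eq_or_ne d 0 with rfl | hd
      · simpa using h
      · field_simp
        ring
  · have hc : c ≠ 0 := norm_pos_iff.1 ((norm_nonneg d).trans_lt h)
    refine ⟨0, -1, 1, d / c, by simp, by simp, by simp, ?_, by simp, ?_⟩
    · rw [norm_div]
      exact div_le_one_of_le₀ h.le (norm_nonneg _)
    · field_simp
      ring

/-- The local matrices are integral at every place, so arbitrary local choices assemble into finite
adeles. -/
theorem exists_mem_maxCompactFin_mul_inv (g : GL (Fin 2) 𝔸ᶠ[K]) :
    ∃ q ∈ maxCompactFin K, (g * q⁻¹).val 1 0 = 0 := by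
  choose a b c d ha hb hc hd hdet h using fun v : HeightOneSpectrum (𝓞 K) =>
    exists_norm_le_one_det_one (g.val 1 0 v) (g.val 1 1 v)
  have key (x : ∀ v : HeightOneSpectrum (𝓞 K), v.adicCompletion K) (hx : ∀ v, ‖x v‖ ≤ 1) :
      ∃ y : 𝔸ᶠ[K], y ∈ integralFiniteAdeles K ∧ ∀ v, y v = x v :=
    ⟨⟨x, Filter.Eventually.of_forall fun v => norm_le_one_iff_mem_integers.1 (hx v)⟩,
      fun v => norm_le_one_iff_mem_integers.1 (hx v), fun _ => rfl⟩
  obtain ⟨a', ha', haa⟩ := key a ha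
  obtain ⟨b', hb', hbb⟩ := key b hb
  obtain ⟨c', hc', hcc⟩ := key c hc
  obtain ⟨d', hd', hdd⟩ := key d hd
  have hdet' : a' * d' - b' * c' = 1 := FiniteAdeleRing.ext _ fun v => by
    change a' v * d' v - b' v * c' v = 1
    rw [haa, hbb, hcc, hdd, hdet]
  refine ⟨slMat a' b' c' d' hdet', slMat_mem_maxCompactFin hdet' ha' hb' hc' hd', ?_⟩
  rw [mul_slMat_inv_val_one_zero]
  refine FiniteAdeleRing.ext _ fun v => ?_
  change g.val 1 0 v * d' v - g.val 1 1 v * c' v = 0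
  rw [hcc, hdd, h]

end FinReg

/-! ### The archimedean Iwasawa decomposition by explicit formulas, its adelic form, and bounds on
the torus part. -/

namespace FinReg

section

variable {K : Type*} [Field K]

/-- The squared length of the bottom row of a matrix at an infinite place. -/
def rowNorm (m : Fin 2 → Fin 2 → mixedEmbedding.mixedSpace K) (w : InfinitePlace K) : ℝ :=
  Complex.normSq (mixedAt w (m 1 0)) + Complex.normSq (mixedAt w (m 1 1))

/-- The matrices over `ℝ^{r₁} × ℂ^{r₂}` whose bottom row is nowhere zero. -/
def rowRegular (K : Type*) [Field K] :
    Set (Fin 2 → Fin 2 → mixedEmbedding.mixedSpace K) :=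
  {m | ∀ w, 0 < rowNorm m w}

/-- The inverse of the length of the bottom row. -/
def rowScale (m : Fin 2 → Fin 2 → mixedEmbedding.mixedSpace K) : mixedEmbedding.mixedSpace K :=
  ofRealFun fun w => (√(rowNorm m w))⁻¹

/-- The special unitary matrix whose bottom row is the normalized bottom row of a matrix. -/
def compactPart (m : Fin 2 → Fin 2 → mixedEmbedding.mixedSpace K) :
    Fin 2 → Fin 2 → mixedEmbedding.mixedSpace K :=
  ![![rowScale m * star (m 1 1), -(rowScale m * star (m 1 0))],
    ![rowScale m * m 1 0, rowScale m * m 1 1]]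

theorem star_rowScale (m : Fin 2 → Fin 2 → mixedEmbedding.mixedSpace K) :
    star (rowScale m) = rowScale m :=
  mixedAt_ext fun w => by simp [mixedAt_star, rowScale]

theorem rowScale_mul_self {m : Fin 2 → Fin 2 → mixedEmbedding.mixedSpace K}
    (hm : m ∈ rowRegular K) :
    rowScale m * rowScale m * (m 1 1 * star (m 1 1) + m 1 0 * star (m 1 0)) = 1 := by
  refine mixedAt_ext fun w => ?_
  have h0 : √(rowNorm m w) ≠ 0 := (Real.sqrt_pos.2 (hm w)).ne'
  have h1 : (rowNorm m w : ℂ) = (√(rowNorm m w) : ℂ) * √(rowNorm m w) := by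
    rw [← Complex.ofReal_mul, Real.mul_self_sqrt (hm w).le]
  simp only [map_mul, map_add, mixedAt_star, rowScale, mixedAt_ofRealFun, RCLike.star_def,
    Complex.mul_conj, map_one, ← Complex.ofReal_add]
  rw [add_comm (Complex.normSq (mixedAt w (m 1 1)))]
  change _ * ((rowNorm m w : ℝ) : ℂ) = 1
  rw [h1]
  have : (√(rowNorm m w) : ℂ) ≠ 0 := by exact_mod_cast h0
  push_cast
  field_simp

theorem det_compactPart {m : Fin 2 → Fin 2 → mixedEmbedding.mixedSpace K}
    (hm : m ∈ rowRegular K) :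
    compactPart m 0 0 * compactPart m 1 1 - compactPart m 0 1 * compactPart m 1 0 = 1 := by
  rw [← rowScale_mul_self hm]
  simp only [compactPart, Matrix.cons_val_zero, Matrix.cons_val_one]
  ring

theorem compactPart_mem {m : Fin 2 → Fin 2 → mixedEmbedding.mixedSpace K}
    (hm : m ∈ rowRegular K) :
    Matrix.of (compactPart m) ∈
      Matrix.specialUnitaryGroup (Fin 2) (mixedEmbedding.mixedSpace K) := by
  refine Matrix.mem_specialUnitaryGroup_iff.2 ⟨?_, ?_⟩
  · rw [Matrix.mem_unitaryGroup_iff]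
    have h := rowScale_mul_self hm
    ext1 i j
    rw [Matrix.mul_apply, Fin.sum_univ_two]
    fin_cases i <;> fin_cases j <;>
      simp only [Matrix.star_apply, Matrix.of_apply, compactPart, Matrix.cons_val_zero,
        Matrix.cons_val_one, star_mul', star_neg, star_rowScale, star_star, Fin.zero_eta,
        Fin.mk_one, Matrix.one_apply_eq] <;>
      first
      | linear_combination h
      | (rw [Matrix.one_apply_ne (by decide)]; ring)
  · rw [Matrix.det_fin_two]
    exact det_compactPart hm

theorem infMatrix_mem_rowRegular (h : GL (Fin 2) K∞) : infMatrix h ∈ rowRegular K := by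
  intro w
  have hd : IsUnit (mixedAt w (InfiniteAdeleRing.ringEquiv_mixedSpace K (h.val.det))) :=
    (((Matrix.isUnit_iff_isUnit_det _).1 h.isUnit).map
      (InfiniteAdeleRing.ringEquiv_mixedSpace K)).map (mixedAt w)
  rw [Matrix.det_fin_two, map_sub, map_mul, map_mul, map_sub, map_mul, map_mul] at hd
  by_contra hneg
  have h0 : mixedAt w (infMatrix h 1 0) = 0 := by
    rw [← Complex.normSq_eq_zero]
    have h1 := Complex.normSq_nonneg (mixedAt w (infMatrix h 1 0))
    have h2 := Complex.normSq_nonneg (mixedAt w (infMatrix h 1 1))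
    unfold rowNorm at hneg
    linarith
  have h1 : mixedAt w (infMatrix h 1 1) = 0 := by
    rw [← Complex.normSq_eq_zero]
    have h1 := Complex.normSq_nonneg (mixedAt w (infMatrix h 1 0))
    have h2 := Complex.normSq_nonneg (mixedAt w (infMatrix h 1 1))
    unfold rowNorm at hneg
    linarith
  unfold infMatrix at h0 h1
  rw [h0, h1, mul_zero, mul_zero, sub_zero] at hd
  exact not_isUnit_zero hd

end

variable {K : Type*} [Field K] [NumberField K]

/-- The bottom row of `h` is its length times the bottom row of the unitary `q`, so `h q⁻¹` has
bottom row `(0, length)`. Both `q` and the length are recorded as formulas in `h`, from which smooth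
dependence is read off later. -/
theorem exists_infMatrix_eq_compactPart (h : GL (Fin 2) K∞) :
    ∃ q ∈ maxCompactInf K, infMatrix q = compactPart (infMatrix h) ∧ (h * q⁻¹).val 1 0 = 0 ∧
      InfiniteAdeleRing.ringEquiv_mixedSpace K ((h * q⁻¹).val 1 1) =
        ofRealFun fun w => √(rowNorm (infMatrix h) w) := by
  set m := infMatrix h with hm_def
  have hm : m ∈ rowRegular K := infMatrix_mem_rowRegular h
  set e := InfiniteAdeleRing.ringEquiv_mixedSpace K
  have hdet : e.symm (compactPart m 0 0) * e.symm (compactPart m 1 1) -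
      e.symm (compactPart m 0 1) * e.symm (compactPart m 1 0) = 1 := by
    rw [← map_mul, ← map_mul, ← map_sub, det_compactPart hm, map_one]
  have hq : infMatrix (slMat _ _ _ _ hdet) = compactPart m := by
    ext1 i
    ext1 j
    fin_cases i <;> fin_cases j <;> exact e.apply_symm_apply _
  have hij (i j : Fin 2) : e (h.val i j) = m i j := rfl
  refine ⟨slMat _ _ _ _ hdet, mem_maxCompactInf_iff.2 ?_, hq, ?_, ?_⟩
  · rw [hq]
    exact compactPart_mem hm
  · apply e.injective
    rw [mul_slMat_inv_val_one_zero, map_sub, map_mul, map_mul, hij, hij, e.apply_symm_apply,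
      e.apply_symm_apply, map_zero]
    simp only [compactPart, Matrix.cons_val_zero, Matrix.cons_val_one]
    ring
  · rw [mul_slMat_inv_val_one_one, map_sub, map_mul, map_mul, hij, hij, e.apply_symm_apply,
      e.apply_symm_apply]
    have key : rowScale m * (ofRealFun fun w => √(rowNorm m w)) = 1 := mixedAt_ext fun w => by
      have h0 : (√(rowNorm m w) : ℂ) ≠ 0 := by
        exact_mod_cast (Real.sqrt_pos.2 (hm w)).ne'
      simp [rowScale, inv_mul_cancel₀ h0]
    have h2 := rowScale_mul_self hm
    simp only [compactPart, Matrix.cons_val_zero, Matrix.cons_val_one]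
    linear_combination (ofRealFun fun w => √(rowNorm m w)) * h2 -
      rowScale m * (m 1 1 * star (m 1 1) + m 1 0 * star (m 1 0)) * key

/-- **Iwasawa decomposition** of `GL₂(𝔸)`. -/
theorem exists_iwasawa (g : GL (Fin 2) 𝔸[K]) :
    ∃ (t₁ t₂ : 𝔸[K]ˣ) (x : 𝔸[K]) (k : maxCompact K), g = borel t₁ x t₂ * k.1 := by
  obtain ⟨q, hq, -, hq0, -⟩ := exists_infMatrix_eq_compactPart (glInf g)
  obtain ⟨r, hr, hr0⟩ := exists_mem_maxCompactFin_mul_inv (glFin g)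
  obtain ⟨t₁, t₂, x, h⟩ := exists_eq_borel (g * (glMk q r)⁻¹) (Prod.ext
    (by rw [← glInf_val, map_mul, map_inv, glInf_glMk, hq0]; rfl)
    (by rw [← glFin_val, map_mul, map_inv, glFin_glMk, hr0]; rfl))
  exact ⟨t₁, t₂, x, ⟨glMk q r, glMk_mem_maxCompact hq hr⟩, by rw [← h, inv_mul_cancel_right]⟩

/-! ## Boundedness -/

theorem norm_sum_mul_mul_le_sum {F : Type*} [NormedField F] {k g k' : Fin 2 → Fin 2 → F}
    (hk : ∀ i j, ‖k i j‖ ≤ 1) (hk' : ∀ i j, ‖k' i j‖ ≤ 1) (i j : Fin 2) :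
    ‖∑ b, (∑ a, k i a * g a b) * k' b j‖ ≤ ∑ b, ∑ a, ‖g a b‖ := by
  refine (norm_sum_le _ _).trans (Finset.sum_le_sum fun b _ => ?_)
  rw [norm_mul]
  refine (mul_le_of_le_one_right (norm_nonneg _) (hk' b j)).trans ?_
  refine (norm_sum_le _ _).trans (Finset.sum_le_sum fun a _ => ?_)
  rw [norm_mul]
  exact mul_le_of_le_one_left (norm_nonneg _) (hk i a)

/-- At finite places the bound must be a maximum and not a sum: it is then `1` wherever `g` is
integral, as the product over all places requires. -/
theorem norm_sum_mul_mul_le_of_ultrametric {F : Type*} [NormedField F] [IsUltrametricDist F]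
    {k g k' : Fin 2 → Fin 2 → F} {C : ℝ} (hk : ∀ i j, ‖k i j‖ ≤ 1) (hk' : ∀ i j, ‖k' i j‖ ≤ 1)
    (hg : ∀ i j, ‖g i j‖ ≤ C) (i j : Fin 2) :
    ‖∑ b, (∑ a, k i a * g a b) * k' b j‖ ≤ C := by
  have hC : 0 ≤ C := (norm_nonneg _).trans (hg 0 0)
  refine IsUltrametricDist.norm_sum_le_of_forall_le_of_nonneg hC fun b _ => ?_
  rw [norm_mul]
  refine (mul_le_of_le_one_right (norm_nonneg _) (hk' b j)).trans ?_
  refine IsUltrametricDist.norm_sum_le_of_forall_le_of_nonneg hC fun a _ => ?_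
  rw [norm_mul]
  exact (mul_le_of_le_one_left (norm_nonneg _) (hk i a)).trans (hg a b)

/-- The entries of `k g k'` that are ideles have bounded norm for `k`, `k'` in `𝐊`. -/
theorem exists_ideleNorm_entry_le (g : GL (Fin 2) 𝔸[K]) :
    ∃ C : ℝ, ∀ k ∈ maxCompact K, ∀ k' ∈ maxCompact K, ∀ (y : 𝔸[K]ˣ) (i j : Fin 2),
      (k * g * k').val i j = y → ideleNorm K y ≤ C := by
  -- The maximum with `1` makes `N` equal to `1` at every place where `g` is integral, hence almost
  -- everywhere.
  let N : HeightOneSpectrum (𝓞 K) → ℝ := fun v =>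
    max 1 (Finset.univ.sup' Finset.univ_nonempty fun p : Fin 2 × Fin 2 => ‖finAt v (g.val p.1 p.2)‖)
  have hN : Function.HasFiniteMulSupport N := by
    refine (Set.finite_iUnion fun p : Fin 2 × Fin 2 =>
      finite_one_lt_norm_finAt (g.val p.1 p.2)).subset fun v hv => ?_
    by_contra hv'
    simp only [Set.mem_iUnion, Set.mem_ofPred_eq, not_exists, not_lt] at hv'
    exact hv (max_eq_left (Finset.sup'_le _ _ fun p _ => hv' p))
  refine ⟨_, fun k hk k' hk' y i j hy =>
    ideleNorm_le_of_le (A := fun w => ∑ b, ∑ a, ‖infAt w (g.val a b)‖) hN y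
      (fun w => ?_) fun v => ?_⟩
  · rw [← hy]
    change ‖infAt w ((k.val * g.val * k'.val) i j)‖ ≤ _
    simp only [Matrix.mul_apply, map_sum, map_mul]
    exact norm_sum_mul_mul_le_sum (norm_infAt_maxCompact_le_one hk w)
      (norm_infAt_maxCompact_le_one hk' w) i j
  · rw [← hy]
    change ‖finAt v ((k.val * g.val * k'.val) i j)‖ ≤ _
    simp only [Matrix.mul_apply, map_sum, map_mul]
    exact norm_sum_mul_mul_le_of_ultrametric (norm_finAt_maxCompact_le_one hk v)
      (norm_finAt_maxCompact_le_one hk' v) (fun a b => le_max_of_le_right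
        (Finset.le_sup' (fun p : Fin 2 × Fin 2 => ‖finAt v (g.val p.1 p.2)‖)
          (Finset.mem_univ (a, b)))) i j

/-- Here `t₁` is a diagonal entry of `k g k'⁻¹` and `t₂⁻¹` one of `k' g⁻¹ k⁻¹`. -/
theorem exists_ideleNorm_div_le (g : GL (Fin 2) 𝔸[K]) :
    ∃ C : ℝ, ∀ (k k' : maxCompact K) (t₁ t₂ : 𝔸[K]ˣ) (x : 𝔸[K]),
      k.1 * g = borel t₁ x t₂ * k'.1 → ideleNorm K (t₁ * t₂⁻¹) ≤ C := by
  obtain ⟨C, hC⟩ := exists_ideleNorm_entry_le g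
  obtain ⟨D, hD⟩ := exists_ideleNorm_entry_le g⁻¹
  refine ⟨C * D, fun k k' t₁ t₂ x h => ?_⟩
  have h1 : k.1 * g * k'.1⁻¹ = borel t₁ x t₂ := by rw [h, mul_inv_cancel_right]
  have h2 : k'.1 * g⁻¹ * k.1⁻¹ = borel t₁⁻¹ (-(↑t₁⁻¹ * x * ↑t₂⁻¹)) t₂⁻¹ := by
    rw [← borel_inv, ← h1]
    group
  have h3 := hC k.1 k.2 _ (inv_mem k'.2) t₁ 0 0 (by rw [h1]; rfl)
  have h4 := hD k'.1 k'.2 _ (inv_mem k.2) t₂⁻¹ 1 1 (by rw [h2]; rfl)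
  rw [ideleNorm_mul]
  exact mul_le_mul h3 h4 (ideleNorm_pos _).le ((ideleNorm_pos _).le.trans h3)

/-- Inverting the decomposition gives one of `k' g⁻¹` with `t₁/t₂` inverted, so the upper bound for
`g⁻¹` applies. -/
theorem exists_le_ideleNorm_div (g : GL (Fin 2) 𝔸[K]) :
    ∃ c : ℝ, 0 < c ∧ ∀ (k k' : maxCompact K) (t₁ t₂ : 𝔸[K]ˣ) (x : 𝔸[K]),
      k.1 * g = borel t₁ x t₂ * k'.1 → c ≤ ideleNorm K (t₁ * t₂⁻¹) := by
  obtain ⟨C, hC⟩ := exists_ideleNorm_div_le g⁻¹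
  refine ⟨(max C 1)⁻¹, by positivity, fun k k' t₁ t₂ x h => ?_⟩
  have h1 : k'.1 * g⁻¹ = borel t₁⁻¹ (-(↑t₁⁻¹ * x * ↑t₂⁻¹)) t₂⁻¹ * k.1 := by
    rw [← borel_inv, eq_inv_mul_iff_mul_eq, ← mul_assoc, ← h]
    group
  have h2 := hC _ _ _ _ _ h1
  rw [← mul_inv, ideleNorm_inv] at h2
  exact inv_le_of_inv_le₀ (ideleNorm_pos _) (h2.trans (le_max_left _ _))

/-- The matrix and its inverse both have entries of norm at most `1` at every place, so neither
diagonal norm nor its inverse exceeds `1`. -/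
theorem ideleNorm_eq_one_of_borel_mem {t₁ t₂ : 𝔸[K]ˣ} {x : 𝔸[K]}
    (hb : borel t₁ x t₂ ∈ maxCompact K) : ideleNorm K t₁ = 1 ∧ ideleNorm K t₂ = 1 := by
  have key (y : 𝔸[K]ˣ) (k : GL (Fin 2) 𝔸[K]) (hk : k ∈ maxCompact K) (i : Fin 2)
      (hy : k.val i i = y) : ideleNorm K y ≤ 1 := by
    have := ideleNorm_le_of_le (A := fun _ => 1) (N := fun _ => 1)
      (by simp [Function.HasFiniteMulSupport]) y
      (fun w => hy ▸ norm_infAt_maxCompact_le_one hk w i i)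
      (fun v => hy ▸ norm_finAt_maxCompact_le_one hk v i i)
    simpa using this
  have hb' := inv_mem hb
  rw [borel_inv] at hb'
  have h1 := key t₁ _ hb 0 rfl
  have h2 := key t₂ _ hb 1 rfl
  have h3 := key t₁⁻¹ _ hb' 0 rfl
  have h4 := key t₂⁻¹ _ hb' 1 rfl
  rw [ideleNorm_inv] at h3 h4
  exact ⟨le_antisymm h1 ((inv_le_one₀ (ideleNorm_pos _)).1 h3),
    le_antisymm h2 ((inv_le_one₀ (ideleNorm_pos _)).1 h4)⟩

end FinReg

namespace FinReg

/-! ## Continuous characters of real vector spaces -/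

/-- Integrating the functional equation over `[0, a]` gives `f(x) F(a) = F(x + a) - F(x)` for the
primitive `F`. Some `F(a)` is nonzero because `F'(0) = 1`, so `f` is differentiable, with `f' = c
f`. -/
theorem exists_eq_exp_of_continuous_mul {f : ℝ → ℂ} (hf : Continuous f) (h0 : f 0 = 1)
    (hadd : ∀ x y, f (x + y) = f x * f y) : ∃ c : ℂ, ∀ x, f x = Complex.exp (c * x) := by
  let F : ℝ → ℂ := fun x => ∫ t in (0 : ℝ)..x, f t
  have hF (x : ℝ) : HasDerivAt F (f x) x :=
    intervalIntegral.integral_hasDerivAt_right (hf.intervalIntegrable _ _)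
      (hf.stronglyMeasurableAtFilter _ _) hf.continuousAt
  obtain ⟨a, ha⟩ : ∃ a, F a ≠ 0 := by
    by_contra! h
    have h1 : F = fun _ => 0 := funext h
    have h2 := hF 0
    rw [h1, h0] at h2
    exact zero_ne_one ((hasDerivAt_const (0 : ℝ) (0 : ℂ)).unique h2)
  have h1 (x : ℝ) : f x * F a = F (x + a) - F x := by
    have h2 : F (x + a) - F x = ∫ t in x..(x + a), f t :=
      intervalIntegral.integral_interval_sub_left (hf.intervalIntegrable _ _)
        (hf.intervalIntegrable _ _)
    have h3 : ∫ t in x..(x + a), f t = ∫ t in (0 : ℝ)..a, f (x + t) := by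
      rw [intervalIntegral.integral_comp_add_left, add_zero]
    rw [h2, h3, ← intervalIntegral.integral_const_mul]
    exact intervalIntegral.integral_congr fun t _ => (hadd x t).symm
  set c : ℂ := (f a - 1) / F a
  have h2 (x : ℝ) : HasDerivAt f (c * f x) x := by
    have h3 : f = fun x => (F (x + a) - F x) / F a := funext fun x => by
      rw [← h1, mul_div_cancel_right₀ _ ha]
    have h4 : HasDerivAt (fun x => (F (x + a) - F x) / F a) ((f (x + a) - f x) / F a) x :=
      (((hF (x + a)).comp_add_const x a).sub (hF x)).div_const _
    rw [← h3] at h4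
    convert h4 using 1
    rw [hadd]
    simp only [c]
    ring
  have h3 (x : ℝ) : HasDerivAt (fun x : ℝ => f x * Complex.exp (-(c * x))) 0 x := by
    have h4 : HasDerivAt (fun x : ℝ => Complex.exp (-(c * x)))
        (Complex.exp (-(c * x)) * (-(c * 1))) x :=
      (((Complex.ofRealCLM.hasDerivAt (x := x)).const_mul c).neg).cexp
    exact ((h2 x).mul h4).congr_deriv (by ring)
  refine ⟨c, fun x => ?_⟩
  have h4 := is_const_of_deriv_eq_zero (fun x => (h3 x).differentiableAt) (fun x => (h3 x).deriv)
    x 0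
  simp only [h0, Complex.ofReal_zero, mul_zero, neg_zero, Complex.exp_zero, mul_one] at h4
  rwa [Complex.exp_neg, mul_inv_eq_one₀ (Complex.exp_ne_zero _)] at h4

theorem contDiff_of_continuous_mul {ι : Type*} [Fintype ι] {f : (ι → ℝ) → ℂ} (hf : Continuous f)
    (h0 : f 0 = 1) (hadd : ∀ x y, f (x + y) = f x * f y) {n : WithTop ℕ∞} :
    ContDiff ℝ n f := by
  classical
  have h1 (i : ι) : ∃ c : ℂ, ∀ t : ℝ, f (Pi.single i t) = Complex.exp (c * t) :=
    exists_eq_exp_of_continuous_mul (f := fun t => f (Pi.single i t))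
      (hf.comp (continuous_single (A := fun _ => ℝ) i)) (by simp [h0])
      fun x y => by rw [Pi.single_add, hadd]
  choose c hc using h1
  have h2 (s : Finset ι) (g : ι → ι → ℝ) : f (∑ i ∈ s, g i) = ∏ i ∈ s, f (g i) := by
    induction s using Finset.induction_on with
    | empty => simp [h0]
    | insert i s hi ih => rw [Finset.sum_insert hi, Finset.prod_insert hi, hadd, ih]
  have h3 : f = fun x => ∏ i, Complex.exp (c i * (x i : ℂ)) := funext fun x => by
    conv_lhs => rw [← Finset.univ_sum_single x, h2]
    exact Finset.prod_congr rfl fun i _ => hc i _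
  rw [h3]
  refine contDiff_prod fun i _ => ?_
  exact (contDiff_const.mul (Complex.ofRealCLM.contDiff.comp (contDiff_apply ℝ ℝ i))).cexp

/-! ## Positive archimedean ideles -/

section

variable {K : Type*} [Field K]

theorem ofRealFun_exp_mul_exp_neg (x : InfinitePlace K → ℝ) :
    ofRealFun (fun w => Real.exp (x w)) * ofRealFun (fun w => Real.exp (-x w)) = 1 :=
  mixedAt_ext fun w => by
    rw [map_mul, mixedAt_ofRealFun, mixedAt_ofRealFun, map_one, ← Complex.ofReal_mul,
      ← Real.exp_add, add_neg_cancel, Real.exp_zero, Complex.ofReal_one]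

theorem continuous_ringEquiv_symm_ofRealFun {X : Type*} [TopologicalSpace X]
    {f : X → InfinitePlace K → ℝ} (hf : Continuous f) :
    Continuous fun x => (InfiniteAdeleRing.ringEquiv_mixedSpace K).symm (ofRealFun (f x)) := by
  refine continuous_pi fun w => ?_
  rw [(InfinitePlace.Completion.isometry_extensionEmbedding w).isEmbedding.continuous_iff]
  have h : (InfinitePlace.Completion.extensionEmbedding w ∘ fun x =>
      (InfiniteAdeleRing.ringEquiv_mixedSpace K).symm (ofRealFun (f x)) w) =
      fun x => (f x w : ℂ) := funext fun x => by
    rw [Function.comp_apply, ← mixedAt_ringEquiv, RingEquiv.apply_symm_apply, mixedAt_ofRealFun]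
  rw [h]
  fun_prop

end

variable {K : Type*} [Field K] [NumberField K]

/-- The idele with components `exp (x w)` at the infinite places `w` and `1` at the finite ones. -/
def expIdele (x : InfinitePlace K → ℝ) : 𝔸[K]ˣ where
  val := ((InfiniteAdeleRing.ringEquiv_mixedSpace K).symm (ofRealFun fun w => Real.exp (x w)), 1)
  inv := ((InfiniteAdeleRing.ringEquiv_mixedSpace K).symm (ofRealFun fun w => Real.exp (-x w)), 1)
  val_inv := Prod.ext
    (show _ * _ = (1 : K∞) by rw [← map_mul, ofRealFun_exp_mul_exp_neg, map_one])
    (one_mul (1 : 𝔸ᶠ[K]))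
  inv_val := Prod.ext
    (show _ * _ = (1 : K∞) by
      rw [← map_mul, mul_comm (ofRealFun _), ofRealFun_exp_mul_exp_neg, map_one])
    (one_mul (1 : 𝔸ᶠ[K]))

theorem expIdele_fst (x : InfinitePlace K → ℝ) :
    InfiniteAdeleRing.ringEquiv_mixedSpace K (expIdele x : 𝔸[K]).1 =
      ofRealFun fun w => Real.exp (x w) :=
  (InfiniteAdeleRing.ringEquiv_mixedSpace K).apply_symm_apply _

theorem adele_ext {x y : 𝔸[K]} (h1 : InfiniteAdeleRing.ringEquiv_mixedSpace K x.1 =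
    InfiniteAdeleRing.ringEquiv_mixedSpace K y.1) (h2 : x.2 = y.2) : x = y :=
  Prod.ext ((InfiniteAdeleRing.ringEquiv_mixedSpace K).injective h1) h2

theorem expIdele_add (x y : InfinitePlace K → ℝ) :
    expIdele (x + y) = expIdele x * expIdele y := by
  refine Units.ext (adele_ext ?_ ?_)
  · rw [expIdele_fst]
    change _ = InfiniteAdeleRing.ringEquiv_mixedSpace K
      ((expIdele x : 𝔸[K]).1 * (expIdele y : 𝔸[K]).1)
    rw [map_mul, expIdele_fst, expIdele_fst]
    refine mixedAt_ext fun w => ?_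
    simp [Real.exp_add]
  · exact (one_mul (1 : 𝔸ᶠ[K])).symm

theorem expIdele_zero : expIdele (0 : InfinitePlace K → ℝ) = 1 :=
  mul_left_cancel (a := expIdele 0) (by rw [← expIdele_add, add_zero, mul_one])

theorem continuous_expIdele : Continuous (expIdele (K := K)) := by
  rw [Units.continuous_iff]
  constructor
  · exact Continuous.prodMk (continuous_ringEquiv_symm_ofRealFun
      (f := fun (x : InfinitePlace K → ℝ) w => Real.exp (x w)) (by fun_prop))
      (continuous_const (y := (1 : 𝔸ᶠ[K])))
  · exact Continuous.prodMk (continuous_ringEquiv_symm_ofRealFun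
      (f := fun (x : InfinitePlace K → ℝ) w => Real.exp (-x w)) (by fun_prop))
      (continuous_const (y := (1 : 𝔸ᶠ[K])))

theorem log_ideleNorm_expIdele (x : InfinitePlace K → ℝ) :
    Real.log (ideleNorm K (expIdele x)) = ∑ w, w.mult * x w := by
  have h1 (w : InfinitePlace K) : ‖infAt w (expIdele x : 𝔸[K])‖ = Real.exp (x w) := by
    change ‖(expIdele x : 𝔸[K]).1 w‖ = _
    rw [← norm_mixedAt_ringEquiv, expIdele_fst, mixedAt_ofRealFun, Complex.norm_real,
      Real.norm_of_nonneg (Real.exp_pos _).le]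
  have h2 (v : HeightOneSpectrum (𝓞 K)) : ‖finAt v (expIdele x : 𝔸[K])‖ = 1 :=
    norm_one (α := v.adicCompletion K)
  rw [ideleNorm_eq]
  simp only [h1, h2, finprod_one, mul_one]
  rw [Real.log_prod fun w _ => (pow_pos (Real.exp_pos _) _).ne']
  simp

/-- Restricted along `expIdele`, `χ` is a continuous character of a real vector space, hence a
product of exponentials. -/
theorem contDiff_heckeCharacter_expIdele (χ : HeckeCharacter K) {n : WithTop ℕ∞} :
    ContDiff ℝ n fun x : InfinitePlace K → ℝ => (χ (expIdele x) : ℂ) := by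
  refine contDiff_of_continuous_mul ?_ ?_ fun x y => ?_
  · exact continuous_subtype_val.comp (χ.toHom.continuous_toFun.comp continuous_expIdele)
  · rw [expIdele_zero, map_one, Circle.coe_one]
  · rw [expIdele_add, map_mul, Circle.coe_mul]

theorem contDiff_log_ideleNorm_expIdele {n : WithTop ℕ∞} :
    ContDiff ℝ n fun x : InfinitePlace K → ℝ => Real.log (ideleNorm K (expIdele x)) := by
  simp only [log_ideleNorm_expIdele]
  exact ContDiff.sum fun w _ => contDiff_const.mul (contDiff_apply ℝ ℝ w)

end FinReg

namespace FinReg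

/-! ## Smoothness of the archimedean Iwasawa decomposition -/

section MulRight

variable {K : Type*} [Field K]

/-- Right multiplication of matrices over `ℝ^{r₁} × ℂ^{r₂}` by a fixed matrix. -/
def mulRight (g : Fin 2 → Fin 2 → mixedEmbedding.mixedSpace K)
    (m : Fin 2 → Fin 2 → mixedEmbedding.mixedSpace K) :
    Fin 2 → Fin 2 → mixedEmbedding.mixedSpace K :=
  fun i j => m i 0 * g 0 j + m i 1 * g 1 j

theorem infMatrix_mul (h g : GL (Fin 2) K∞) :
    infMatrix (h * g) = mulRight (infMatrix g) (infMatrix h) := by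
  ext1 i
  ext1 j
  change InfiniteAdeleRing.ringEquiv_mixedSpace K ((h.val * g.val) i j) = _
  rw [Matrix.mul_apply, Fin.sum_univ_two, map_add, map_mul, map_mul]
  rfl

theorem isUnit_mulRight_infMatrix (g : GL (Fin 2) K∞)
    {m : Fin 2 → Fin 2 → mixedEmbedding.mixedSpace K} (hm : IsUnit (Matrix.of m)) :
    IsUnit (Matrix.of (mulRight (infMatrix g) m)) := by
  have h : Matrix.of (mulRight (infMatrix g) m) = Matrix.of m *
      (Matrix.GeneralLinearGroup.map (InfiniteAdeleRing.ringEquiv_mixedSpace K).toRingHom g).val := by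
    ext1 i j
    rw [Matrix.mul_apply, Fin.sum_univ_two]
    rfl
  rw [h]
  exact hm.mul (Units.isUnit _)

end MulRight

/-! ### Smoothness of the decomposition formulas, checked one place at a time. -/

section MixedSmooth

variable {K : Type*} [Field K] [NumberField K]

open scoped Classical in
theorem contDiff_mixedAt (w : InfinitePlace K) {n : WithTop ℕ∞} :
    ContDiff ℝ n (mixedAt (K := K) w) := by
  rcases w.isReal_or_isComplex with h | h
  · have : (mixedAt w : mixedEmbedding.mixedSpace K → ℂ) = fun x => ((x.1 ⟨w, h⟩ : ℝ) : ℂ) :=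
      funext fun x => mixedAt_of_isReal h x
    rw [this]
    exact Complex.ofRealCLM.contDiff.comp ((contDiff_apply ℝ ℝ _).comp contDiff_fst)
  · have : (mixedAt w : mixedEmbedding.mixedSpace K → ℂ) = fun x => x.2 ⟨w, h⟩ :=
      funext fun x => mixedAt_of_isComplex h x
    rw [this]
    exact (contDiff_apply ℝ ℂ _).comp contDiff_snd

open scoped Classical in
theorem contDiffOn_of_mixedAt {E : Type*} [NormedAddCommGroup E] [NormedSpace ℝ E] {s : Set E}
    {f : E → mixedEmbedding.mixedSpace K} {n : WithTop ℕ∞}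
    (h : ∀ w, ContDiffOn ℝ n (fun x => mixedAt w (f x)) s) : ContDiffOn ℝ n f s := by
  refine ContDiffOn.prodMk (f := fun x => (f x).1) (g := fun x => (f x).2)
    (contDiffOn_pi.2 fun w => ?_) (contDiffOn_pi.2 fun w => ?_)
  · refine (Complex.reCLM.contDiff.comp_contDiffOn (h w.1)).congr fun x _ => ?_
    simp [mixedAt_of_isReal w.2]
  · refine (h w.1).congr fun x _ => ?_
    rw [mixedAt_of_isComplex w.2]

open scoped Classical in
theorem contDiff_mixedAt_entry (w : InfinitePlace K) (i j : Fin 2) {n : WithTop ℕ∞} :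
    ContDiff ℝ n fun m : Fin 2 → Fin 2 → mixedEmbedding.mixedSpace K => mixedAt w (m i j) :=
  (contDiff_mixedAt w).comp
    ((contDiff_apply ℝ (mixedEmbedding.mixedSpace K) j).comp (contDiff_apply ℝ _ i))

theorem contDiff_normSq {n : WithTop ℕ∞} : ContDiff ℝ n Complex.normSq := by
  have : (Complex.normSq : ℂ → ℝ) = fun z => ‖z‖ ^ 2 := funext fun z => (Complex.sq_norm z).symm
  rw [this]
  exact contDiff_norm_sq ℝ

open scoped Classical in
theorem contDiff_rowNorm (w : InfinitePlace K) {n : WithTop ℕ∞} :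
    ContDiff ℝ n fun m : Fin 2 → Fin 2 → mixedEmbedding.mixedSpace K => rowNorm m w :=
  (contDiff_normSq.comp (contDiff_mixedAt_entry w 1 0)).add
    (contDiff_normSq.comp (contDiff_mixedAt_entry w 1 1))

open scoped Classical in
theorem isOpen_rowRegular : IsOpen (rowRegular K) := by
  simp only [rowRegular, Set.ofPred_forall]
  exact isOpen_iInter_of_finite fun w =>
    isOpen_lt continuous_const (contDiff_rowNorm w (n := 0)).continuous

/-- Half the logarithm of the squared length of the bottom row, at each infinite place. -/
def logRow (m : Fin 2 → Fin 2 → mixedEmbedding.mixedSpace K) (w : InfinitePlace K) : ℝ :=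
  Real.log √(rowNorm m w)

open scoped Classical in
theorem contDiffOn_sqrt_rowNorm (w : InfinitePlace K) {n : WithTop ℕ∞} :
    ContDiffOn ℝ n (fun m : Fin 2 → Fin 2 → mixedEmbedding.mixedSpace K => √(rowNorm m w))
      (rowRegular K) :=
  (contDiff_rowNorm w).contDiffOn.sqrt fun _ hm => (hm w).ne'

open scoped Classical in
theorem contDiffOn_logRow {n : WithTop ℕ∞} : ContDiffOn ℝ n (logRow (K := K)) (rowRegular K) :=
  contDiffOn_pi.2 fun w => (contDiffOn_sqrt_rowNorm w).log
    fun _ hm => (Real.sqrt_pos.2 (hm w)).ne'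

open scoped Classical in
theorem contDiffOn_compactPart {n : WithTop ℕ∞} :
    ContDiffOn ℝ n (compactPart (K := K)) (rowRegular K) := by
  have hs (w : InfinitePlace K) :
      ContDiffOn ℝ n (fun m => mixedAt w (rowScale m)) (rowRegular K) := by
    simp only [rowScale, mixedAt_ofRealFun]
    exact Complex.ofRealCLM.contDiff.comp_contDiffOn
      ((contDiffOn_sqrt_rowNorm w).inv fun m hm => (Real.sqrt_pos.2 (hm w)).ne')
  have hm (w : InfinitePlace K) (i j : Fin 2) := (contDiff_mixedAt_entry w i j (n := n)).contDiffOn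
    (s := rowRegular K)
  have hstar (w : InfinitePlace K) (i j : Fin 2) : ContDiffOn ℝ n
      (fun m : Fin 2 → Fin 2 → mixedEmbedding.mixedSpace K => star (mixedAt w (m i j)))
      (rowRegular K) :=
    Complex.conjCLE.contDiff.comp_contDiffOn (hm w i j)
  refine contDiffOn_pi.2 fun i => contDiffOn_pi.2 fun j => contDiffOn_of_mixedAt fun w => ?_
  fin_cases i <;> fin_cases j <;>
    simp only [compactPart, Fin.zero_eta, Fin.mk_one, Matrix.cons_val_zero, Matrix.cons_val_one,
      map_neg, map_mul, mixedAt_star]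
  · exact (hs w).mul (hstar w 1 1)
  · exact ((hs w).mul (hstar w 1 0)).neg
  · exact (hs w).mul (hm w 1 0)
  · exact (hs w).mul (hm w 1 1)

open scoped Classical in
theorem contDiff_mulRight (g : Fin 2 → Fin 2 → mixedEmbedding.mixedSpace K) {n : WithTop ℕ∞} :
    ContDiff ℝ n (mulRight g) := by
  refine contDiff_pi.2 fun i => contDiff_pi.2 fun j => ?_
  rw [← contDiffOn_univ]
  refine contDiffOn_of_mixedAt fun w => ?_
  simp only [mulRight, map_add, map_mul]
  exact (((contDiff_mixedAt_entry w i 0).mul contDiff_const).add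
    ((contDiff_mixedAt_entry w i 1).mul contDiff_const)).contDiffOn

end MixedSmooth

/-! ### Smoothness of right translates on `GL₂(𝔸)`, and openness of `K_f`. -/

section Translate

variable {K : Type*} [Field K] [NumberField K]

/-- A function invariant under `U` has its translate by `g` invariant under `g U g⁻¹`; this is the
comap along conjugation by `g⁻¹`. -/
theorem isOpen_conj_comap {U : Subgroup (GL (Fin 2) 𝔸ᶠ[K])}
    (hU : IsOpen (U : Set (GL (Fin 2) 𝔸ᶠ[K]))) (g : GL (Fin 2) 𝔸ᶠ[K]) :
    IsOpen (U.comap (MulAut.conj g).toMonoidHom : Set (GL (Fin 2) 𝔸ᶠ[K])) := by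
  refine hU.preimage (f := fun x => g * x * g⁻¹) ?_
  exact (continuous_const.mul continuous_id).mul continuous_const

open scoped Classical in
theorem IsSmooth.rightTranslate {φ : GL (Fin 2) 𝔸[K] → ℂ} (hφ : IsSmooth φ)
    (g : GL (Fin 2) 𝔸[K]) : IsSmooth (rightTranslate g φ) := by
  obtain ⟨⟨U, hU, h1⟩, h2⟩ := hφ
  refine ⟨⟨_, isOpen_conj_comap hU (glFin g)⁻¹, fun h h' hh hh' => ?_⟩, fun g₀ => ?_⟩
  · refine h1 _ _ (by rw [map_mul, map_mul, hh]) ?_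
    convert! Subgroup.mem_comap.1 hh' using 1
    simp [mul_assoc]
  · obtain ⟨F, hF, hF'⟩ := h2 (g₀ * g)
    refine ⟨F ∘ mulRight (infMatrix (glInf g)),
      hF.comp (contDiff_mulRight _).contDiffOn fun m hm => isUnit_mulRight_infMatrix _ hm,
      fun h hh => ?_⟩
    rw [Function.comp_apply, ← infMatrix_mul, ← map_mul]
    exact hF' _ (by rw [map_mul, map_mul, hh])

theorem isOpen_integralFiniteAdeles : IsOpen (integralFiniteAdeles K : Set 𝔸ᶠ[K]) :=
  RestrictedProduct.isOpen_forall_mem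
    fun v : HeightOneSpectrum (𝓞 K) => Valued.isOpen_valuationSubring (v.adicCompletion K)

theorem isOpen_maxCompactFin : IsOpen (maxCompactFin K : Set (GL (Fin 2) 𝔸ᶠ[K])) := by
  have h1 : IsOpen {m : Matrix (Fin 2) (Fin 2) 𝔸ᶠ[K] | ∀ i j, m i j ∈ integralFiniteAdeles K} := by
    simp only [Set.ofPred_forall]
    refine isOpen_iInter_of_finite fun i => isOpen_iInter_of_finite fun j => ?_
    exact isOpen_integralFiniteAdeles.preimage (continuous_apply_apply i j)
  exact (h1.preimage Units.continuous_val).inter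
    (h1.preimage (Units.continuous_val.comp continuous_inv))

end Translate

end FinReg

namespace FinReg

variable {K : Type*} [Field K] [NumberField K] {ω : HeckeCharacter K}

/-! ## Summands as functions on `GL₂(𝔸)` -/

namespace ExpTerm

/-- The factor `χ(t₁) ω(t₂) χ(t₂)⁻¹ |t₁/t₂|^{1/2 + α} log^j |t₁/t₂|`. -/
def weight (e : ExpTerm ω) (j : ℕ) (t₁ t₂ : 𝔸[K]ˣ) : ℂ :=
  (e.χ t₁ : ℂ) * ((ω t₂ : ℂ) * (e.χ t₂ : ℂ)⁻¹) *
    (ideleNorm K (t₁ * t₂⁻¹) : ℂ) ^ (1 / 2 + e.α) * (Real.log (ideleNorm K (t₁ * t₂⁻¹)) : ℂ) ^ j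

theorem weight_mul (e : ExpTerm ω) (j : ℕ) (t₁ t₂ s₁ s₂ : 𝔸[K]ˣ) (h1 : ideleNorm K s₁ = 1)
    (h2 : ideleNorm K s₂ = 1) :
    e.weight j (t₁ * s₁) (t₂ * s₂) =
      e.weight j t₁ t₂ * ((e.χ s₁ : ℂ) * ((ω s₂ : ℂ) * (e.χ s₂ : ℂ)⁻¹)) := by
  have h3 : ideleNorm K (t₁ * s₁ * (t₂ * s₂)⁻¹) = ideleNorm K (t₁ * t₂⁻¹) := by
    simp only [ideleNorm_mul, ideleNorm_inv, h1, h2, mul_one]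
  rw [weight, h3, weight]
  simp only [map_mul, Circle.coe_mul, mul_inv]
  ring

/-- The function `g ↦ χ(t₁) ω(t₂) χ(t₂)⁻¹ |t₁/t₂|^{1/2 + α} log^j |t₁/t₂| f(k)` of
`g = (t₁, x; 0, t₂) k`. -/
def extend (e : ExpTerm ω) (j : ℕ) (g : GL (Fin 2) 𝔸[K]) : ℂ :=
  e.weight j (exists_iwasawa g).choose (exists_iwasawa g).choose_spec.choose *
    e.f (exists_iwasawa g).choose_spec.choose_spec.choose_spec.choose

/-- Two decompositions differ by an element of `B(𝔸) ∩ 𝐊`. Its diagonal entries have norm `1`, so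
norm and logarithm are unchanged, and the character values picked up by `weight` and by `f`
compensate. -/
theorem extend_borel_mul (e : ExpTerm ω) (j : ℕ) (t₁ t₂ : 𝔸[K]ˣ) (x : 𝔸[K]) (k : maxCompact K) :
    e.extend j (borel t₁ x t₂ * k.1) = e.weight j t₁ t₂ * e.f k := by
  obtain ⟨s₁, s₂, y, q, h, hext⟩ : ∃ (s₁ s₂ : 𝔸[K]ˣ) (y : 𝔸[K]) (q : maxCompact K),
      borel t₁ x t₂ * k.1 = borel s₁ y s₂ * q.1 ∧
      e.extend j (borel t₁ x t₂ * k.1) = e.weight j s₁ s₂ * e.f q :=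
    ⟨_, _, _, _,
      (exists_iwasawa (borel t₁ x t₂ * k.1)).choose_spec.choose_spec.choose_spec.choose_spec, rfl⟩
  have h1 : k.1 * q.1⁻¹ = borel (t₁⁻¹ * s₁) (↑t₁⁻¹ * y + -(↑t₁⁻¹ * x * ↑t₂⁻¹) * ↑s₂)
      (t₂⁻¹ * s₂) := by
    rw [← borel_mul, ← borel_inv, eq_inv_mul_iff_mul_eq, ← mul_assoc, h, mul_inv_cancel_right]
  have hb := h1 ▸ mul_mem k.2 (inv_mem q.2)
  obtain ⟨hs1, hs2⟩ := ideleNorm_eq_one_of_borel_mem hb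
  have h2 : k = ⟨_, hb⟩ * q := Subtype.ext (mul_inv_eq_iff_eq_mul.1 h1)
  rw [hext, h2, e.induced _ _ _ hb q, ← mul_assoc, ← e.weight_mul j _ _ _ _ hs1 hs2,
    mul_inv_cancel_left, mul_inv_cancel_left]

theorem weight_zero_ne_zero (e : ExpTerm ω) (t₁ t₂ : 𝔸[K]ˣ) : e.weight 0 t₁ t₂ ≠ 0 := by
  have h : (ideleNorm K (t₁ * t₂⁻¹) : ℂ) ≠ 0 := by exact_mod_cast (ideleNorm_pos _).ne'
  simp [weight, Complex.cpow_eq_zero_iff, h]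

/-! ### Smoothness of the restriction to translates of `𝐊` -/

/-- The opposite signs match the use: the determinant fixes `t₁ t₂`, so `t₁` shrinks by the factor
by which `t₂` grows. -/
theorem contDiff_weight_expIdele (e : ExpTerm ω) (j : ℕ) (a b : 𝔸[K]ˣ) {n : WithTop ℕ∞} :
    ContDiff ℝ n fun x : InfinitePlace K → ℝ =>
      e.weight j (a * expIdele (-x)) (b * expIdele x) := by
  have hlog : ContDiff ℝ n fun x : InfinitePlace K → ℝ =>
      Real.log (ideleNorm K (a * expIdele (-x) * (b * expIdele x)⁻¹)) := by
    have h (x : InfinitePlace K → ℝ) :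
        Real.log (ideleNorm K (a * expIdele (-x) * (b * expIdele x)⁻¹)) =
        Real.log (ideleNorm K (a * b⁻¹)) + (Real.log (ideleNorm K (expIdele (-x))) -
          Real.log (ideleNorm K (expIdele x))) := by
      have hpos (y : 𝔸[K]ˣ) := (ideleNorm_pos y).ne'
      simp only [ideleNorm_mul, ideleNorm_inv]
      rw [Real.log_mul, Real.log_mul, Real.log_inv, Real.log_mul, Real.log_mul, Real.log_inv]
      · ring
      all_goals simp [hpos]
    simp only [h]
    exact contDiff_const.add ((contDiff_log_ideleNorm_expIdele.comp contDiff_neg).sub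
      contDiff_log_ideleNorm_expIdele)
  have hχ (χ : HeckeCharacter K) (c : 𝔸[K]ˣ) : ContDiff ℝ n fun x : InfinitePlace K → ℝ =>
      (χ (c * expIdele x) : ℂ) := by
    simp only [map_mul, Circle.coe_mul]
    exact contDiff_const.mul (contDiff_heckeCharacter_expIdele χ)
  have hlog' := Complex.ofRealCLM.contDiff.comp hlog
  have hpow : ContDiff ℝ n fun x : InfinitePlace K → ℝ =>
      (ideleNorm K (a * expIdele (-x) * (b * expIdele x)⁻¹) : ℂ) ^ (1 / 2 + e.α) := by
    have h (x : InfinitePlace K → ℝ) :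
        (ideleNorm K (a * expIdele (-x) * (b * expIdele x)⁻¹) : ℂ) ^ (1 / 2 + e.α) =
        Complex.exp ((Real.log (ideleNorm K (a * expIdele (-x) * (b * expIdele x)⁻¹)) : ℂ) *
          (1 / 2 + e.α)) := by
      rw [Complex.cpow_def_of_ne_zero (by exact_mod_cast (ideleNorm_pos _).ne'),
        Complex.ofReal_log (ideleNorm_pos _).le]
    simp only [h]
    exact (hlog'.mul contDiff_const).cexp
  refine (((((hχ e.χ a).comp contDiff_neg).mul ((hχ ω b).mul ?_))).mul hpow).mul (hlog'.pow j)
  exact (hχ e.χ b).inv fun x => Circle.coe_ne_zero _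

theorem induced_extend (e : ExpTerm ω) (j : ℕ) (g : GL (Fin 2) 𝔸[K]) :
    IsInduced ω e.χ fun k => e.extend j (k.1 * g) := by
  intro t₁ t₂ x hb k
  obtain ⟨h1, h2⟩ := ideleNorm_eq_one_of_borel_mem hb
  obtain ⟨s₁, s₂, y, q, h⟩ := exists_iwasawa (k.1 * g)
  dsimp only
  rw [Subgroup.coe_mul, mul_assoc, h, ← mul_assoc, borel_mul, extend_borel_mul, extend_borel_mul,
    mul_comm t₁, mul_comm t₂, weight_mul _ _ _ _ _ _ h1 h2]
  ring

end ExpTerm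

/-- The archimedean determinant is `1` on `K_∞`. This lets `t₁` be recovered from `t₂` in
`ExpTerm.smooth_extend`. -/
theorem det_eq_of_glFin_eq {k k' : GL (Fin 2) 𝔸[K]} (hk : k ∈ maxCompact K)
    (hk' : k' ∈ maxCompact K) (h : glFin k = glFin k') :
    Matrix.GeneralLinearGroup.det k = Matrix.GeneralLinearGroup.det k' := by
  have h1 (q : GL (Fin 2) 𝔸[K]) (hq : q ∈ maxCompact K) :
      InfiniteAdeleRing.ringEquiv_mixedSpace K (q.val.det).1 = 1 := by
    have h2 := (Matrix.mem_specialUnitaryGroup_iff.1 (mem_maxCompactInf_iff.1 (glInf_mem hq))).2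
    rw [Matrix.det_fin_two] at h2 ⊢
    change InfiniteAdeleRing.ringEquiv_mixedSpace K
      ((q.val 0 0).1 * (q.val 1 1).1 - (q.val 0 1).1 * (q.val 1 0).1) = 1
    rw [map_sub, map_mul, map_mul]
    exact h2
  have h3 (q : GL (Fin 2) 𝔸[K]) : (q.val.det).2 = (glFin q).val.det := by
    rw [Matrix.det_fin_two, Matrix.det_fin_two]
    rfl
  refine Units.ext (adele_ext ?_ ?_)
  · exact (h1 k hk).trans (h1 k' hk').symm
  · exact (h3 k).trans (by rw [h]; exact (h3 k').symm)

open scoped Classical in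
-- A small finite change of `k` moves only the compact part of `k g`. With the finite component of
-- `k` fixed, one finite compact part `r` serves all `k`; `t₂` then varies only through the
-- archimedean row lengths, `t₁` follows from the determinant, and the compact part is
-- `compactPart`, smooth in the entries.
theorem ExpTerm.smooth_extend (e : ExpTerm ω) (j : ℕ) (g : GL (Fin 2) 𝔸[K]) :
    IsSmoothOnCompact fun k => e.extend j (k.1 * g) := by
  obtain ⟨⟨U, hU, hUf⟩, hF⟩ := e.smooth
  have hUK : IsOpen ((U ⊓ maxCompactFin K : Subgroup (GL (Fin 2) 𝔸ᶠ[K])) :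
    Set (GL (Fin 2) 𝔸ᶠ[K])) := hU.inter isOpen_maxCompactFin
  refine ⟨⟨_, isOpen_conj_comap hUK (glFin g)⁻¹, fun k k' hk hk' => ?_⟩, fun k₀ => ?_⟩
  -- Then `k' g = (k g) u`. Intersecting `U` with `K_f` puts `u` in `𝐊`, so `k g` and `k' g` share
  -- their triangular part.
  · set u := g⁻¹ * (k.1⁻¹ * k'.1) * g with hu
    have hu1 : glInf u = 1 := by
      rw [hu, map_mul, map_mul, map_mul, map_inv, map_inv, hk, inv_mul_cancel, mul_one,
        inv_mul_cancel]
    have hu2 : glFin u ∈ U ⊓ maxCompactFin K := by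
      convert! Subgroup.mem_comap.1 hk' using 1
    have huK : u ∈ maxCompact K :=
      Subgroup.mem_inf.2 ⟨Subgroup.mem_comap.2 (hu1 ▸ one_mem _), Subgroup.mem_comap.2 hu2.2⟩
    obtain ⟨t₁, t₂, x, q, h⟩ := exists_iwasawa (k.1 * g)
    have h' : k'.1 * g = borel t₁ x t₂ * (q * ⟨u, huK⟩ : maxCompact K).1 := by
      rw [Subgroup.coe_mul, ← mul_assoc, ← h]
      change _ = _ * u
      rw [hu]
      group
    dsimp only
    rw [h, h', extend_borel_mul, extend_borel_mul]
    congr 1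
    refine hUf _ _ ?_ ?_
    · rw [Subgroup.coe_mul, map_mul, hu1, mul_one]
    · rw [Subgroup.coe_mul, map_mul, inv_mul_cancel_left]
      exact hu2.1
  · obtain ⟨r, hr, hr0⟩ := exists_mem_maxCompactFin_mul_inv (glFin (k₀.1 * g))
    set G := infMatrix (glInf g)
    have hdec (k : maxCompact K) (hk : glFin k.1 = glFin k₀.1) :
        ∃ (t₁ t₂ : 𝔸[K]ˣ) (x : 𝔸[K]) (q : maxCompact K), k.1 * g = borel t₁ x t₂ * q.1 ∧
        glFin q.1 = r ∧ infMatrix (glInf q.1) = compactPart (mulRight G (infMatrix (glInf k.1))) ∧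
        (t₂ : 𝔸[K]).2 = (glFin (k₀.1 * g) * r⁻¹).val 1 1 ∧
        InfiniteAdeleRing.ringEquiv_mixedSpace K (t₂ : 𝔸[K]).1 =
          InfiniteAdeleRing.ringEquiv_mixedSpace K
            (expIdele (logRow (mulRight G (infMatrix (glInf k.1)))) : 𝔸[K]).1 := by
      obtain ⟨p, hp, hpm, hp0, hp1⟩ := exists_infMatrix_eq_compactPart (glInf (k.1 * g))
      have hreg := infMatrix_mem_rowRegular (glInf (k.1 * g))
      have hf : glFin (k.1 * g) = glFin (k₀.1 * g) := by rw [map_mul, map_mul, hk]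
      obtain ⟨t₁, t₂, x, h⟩ := exists_eq_borel (k.1 * g * (glMk p r)⁻¹) (Prod.ext
        (by rw [← glInf_val, map_mul, map_inv, glInf_glMk, hp0]; rfl)
        (by rw [← glFin_val, map_mul, map_inv, glFin_glMk, hf, hr0]; rfl))
      rw [map_mul, infMatrix_mul] at hpm hreg
      refine ⟨t₁, t₂, x, ⟨glMk p r, glMk_mem_maxCompact hp hr⟩, by rw [← h, inv_mul_cancel_right],
        glFin_glMk _ _, by rw [glInf_glMk, hpm], ?_, ?_⟩
      · rw [← borel_val_one_one t₁ t₂ x, ← h, ← glFin_val, map_mul, map_inv, glFin_glMk, hf]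
      · rw [expIdele_fst, ← borel_val_one_one t₁ t₂ x, ← h, ← glInf_val, map_mul, map_inv,
          glInf_glMk, hp1, map_mul, infMatrix_mul]
        congr 1
        funext w
        exact (Real.exp_log (Real.sqrt_pos.2 (hreg w))).symm
    obtain ⟨a₁, a₂, x₀, q₀, h₀, hq₀, -, ha2, ha2'⟩ := hdec k₀ rfl
    set ℓ₀ := logRow (mulRight G (infMatrix (glInf k₀.1)))
    obtain ⟨Ω, F, hΩ, hΩ', hFs, hFq⟩ := hF q₀
    -- The torus part is measured from that of the base point `k₀`: `t₂` is multiplied by `expIdele`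
    -- of `ℓ - ℓ₀` and `t₁` by its inverse.
    refine ⟨mulRight G ⁻¹' (rowRegular K ∩ compactPart ⁻¹' Ω), fun m =>
      e.weight j (a₁ * expIdele ℓ₀ * expIdele (-logRow (mulRight G m)))
        (a₂ * (expIdele ℓ₀)⁻¹ * expIdele (logRow (mulRight G m))) *
        F (compactPart (mulRight G m)), ?_, fun h hh => ?_, ?_, fun k hk => ?_⟩
    · refine IsOpen.preimage (contDiff_mulRight G (n := 0)).continuous ?_
      exact (contDiffOn_compactPart (n := 0)).continuousOn.isOpen_inter_preimage isOpen_rowRegular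
        hΩ
    · rw [Set.mem_preimage, ← infMatrix_mul]
      obtain ⟨p, hp, hpm, -⟩ := exists_infMatrix_eq_compactPart (h * glInf g)
      exact ⟨infMatrix_mem_rowRegular _, by rw [Set.mem_preimage, ← hpm]; exact hΩ' p hp⟩
    · have hmaps : Set.MapsTo (mulRight G) (mulRight G ⁻¹' (rowRegular K ∩ compactPart ⁻¹' Ω))
          (rowRegular K) := fun m hm => hm.1
      refine ContDiffOn.mul ?_ ?_
      · exact (e.contDiff_weight_expIdele j _ _).comp_contDiffOn
          (contDiffOn_logRow.comp (contDiff_mulRight G).contDiffOn hmaps)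
      · exact hFs.comp (contDiffOn_compactPart.comp (contDiff_mulRight G).contDiffOn hmaps)
          fun m hm => hm.2
    · obtain ⟨t₁, t₂, x, q, h, hq, hqm, ht2, ht2'⟩ := hdec k hk
      set ℓ := logRow (mulRight G (infMatrix (glInf k.1)))
      have e2 : t₂ * expIdele ℓ₀ = a₂ * expIdele ℓ := by
        refine Units.ext (adele_ext ?_ ?_)
        · change InfiniteAdeleRing.ringEquiv_mixedSpace K
              ((t₂ : 𝔸[K]).1 * (expIdele ℓ₀ : 𝔸[K]).1) =
            InfiniteAdeleRing.ringEquiv_mixedSpace K ((a₂ : 𝔸[K]).1 * (expIdele ℓ : 𝔸[K]).1)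
          rw [map_mul, map_mul, ht2', ha2', mul_comm]
        · change (t₂ : 𝔸[K]).2 * (1 : 𝔸ᶠ[K]) = (a₂ : 𝔸[K]).2 * (1 : 𝔸ᶠ[K])
          rw [ht2, ha2]
      have hdet : t₁ * t₂ = a₁ * a₂ := by
        have hq1 := det_eq_of_glFin_eq q.2 q₀.2 (hq.trans hq₀.symm)
        have hk1 := det_eq_of_glFin_eq k.2 k₀.2 hk
        have h1 := congrArg Matrix.GeneralLinearGroup.det h
        have h2 := congrArg Matrix.GeneralLinearGroup.det h₀
        rw [map_mul, map_mul, det_borel] at h1 h2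
        rw [hk1, h2, hq1] at h1
        exact (mul_right_cancel h1).symm
      have hneg : expIdele (-ℓ) = (expIdele ℓ)⁻¹ :=
        eq_inv_of_mul_eq_one_left (by rw [← expIdele_add, neg_add_cancel, expIdele_zero])
      have e2' : t₂ = a₂ * (expIdele ℓ₀)⁻¹ * expIdele ℓ := by
        rw [mul_right_comm, ← e2, mul_inv_cancel_right]
      have e1 : t₁ = a₁ * expIdele ℓ₀ * expIdele (-ℓ) := by
        rw [hneg, eq_mul_inv_iff_mul_eq]
        apply mul_right_cancel (b := a₂)
        rw [mul_assoc, mul_comm (expIdele ℓ), ← e2, ← mul_assoc, hdet]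
        exact mul_right_comm _ _ _
      dsimp only
      rw [h, extend_borel_mul, e1, e2', ← hqm, hFq q (hq.trans hq₀.symm)]

end FinReg

namespace FinReg

variable {K : Type*} [Field K] [NumberField K] {ω : HeckeCharacter K}

/-! ## Expansions of translates -/

/-- An essential constant term indexed by a finite type. -/
def IsExpansionOn {ι : Type*} [Fintype ι] (φ : GL (Fin 2) 𝔸[K] → ℂ) (e : ι → ExpTerm ω) : Prop :=
  ∀ M : ℝ, ∃ C T : ℝ, ∀ (x : 𝔸[K]) (y : 𝔸[K]ˣ) (k : maxCompact K), T ≤ ideleNorm K y →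
    ‖φ (nMat x * aMat y * k.1) - ∑ i, (e i).value y k‖ ≤ C * ideleNorm K y ^ (-M)

theorem IsExpansionOn.of_sum_eq {ι κ : Type*} [Fintype ι] [Fintype κ] {φ : GL (Fin 2) 𝔸[K] → ℂ}
    {e : ι → ExpTerm ω} {d : κ → ExpTerm ω} (he : IsExpansionOn φ e)
    (h : ∀ y k, ∑ i, (d i).value y k = ∑ i, (e i).value y k) : IsExpansionOn φ d := by
  intro M
  obtain ⟨C, T, hC⟩ := he M
  exact ⟨C, T, fun x y k hy => by rw [h]; exact hC x y k hy⟩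

/-- The summand of degree `m` in `log |y|` of the translate by `g` of a summand. -/
def ExpTerm.translate (e : ExpTerm ω) (g : GL (Fin 2) 𝔸[K]) (m : ℕ) : ExpTerm ω where
  χ := e.χ
  α := e.α
  n := m
  f := fun k => (e.n.choose m : ℂ) * e.extend (e.n - m) (k.1 * g)
  smooth := (e.smooth_extend (e.n - m) g).smul (e.n.choose m : ℂ)
  induced := fun t₁ t₂ x hb k => by
    have := e.induced_extend (e.n - m) g t₁ t₂ x hb k
    dsimp only at this ⊢
    rw [this]
    ring

theorem ExpTerm.exponent_mul (e : ExpTerm ω) (y z : 𝔸[K]ˣ) :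
    e.exponent (y * z) = e.exponent y * e.exponent z := by
  simp only [exponent, quasiCharacter, ideleNorm_mul, map_mul, Circle.coe_mul, Complex.ofReal_mul]
  rw [Complex.mul_cpow_ofReal_nonneg (ideleNorm_pos _).le (ideleNorm_pos _).le]
  ring

/-- The binomial theorem for `log|y| + log|t₁/t₂|`; the factor `ω(t₂)` matches the one produced by
the central character. -/
theorem ExpTerm.sum_translate_value (e : ExpTerm ω) {g : GL (Fin 2) 𝔸[K]} {k q : maxCompact K}
    {t₁ t₂ : 𝔸[K]ˣ} {z : 𝔸[K]} (h : k.1 * g = borel t₁ z t₂ * q.1) (y : 𝔸[K]ˣ) :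
    ∑ m : Fin (e.n + 1), (e.translate g m).value y k =
      (ω t₂ : ℂ) * e.value (y * (t₁ * t₂⁻¹)) q := by
  have h1 : Real.log (ideleNorm K (y * (t₁ * t₂⁻¹))) =
      Real.log (ideleNorm K y) + Real.log (ideleNorm K (t₁ * t₂⁻¹)) := by
    rw [ideleNorm_mul, Real.log_mul (ideleNorm_pos _).ne' (ideleNorm_pos _).ne']
  simp only [value, h1, exponent_mul, Complex.ofReal_add, add_pow, Finset.sum_range,
    Finset.mul_sum, Finset.sum_mul]
  refine Finset.sum_congr rfl fun m _ => ?_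
  have h2 : (e.translate g m).f k =
      (e.n.choose m : ℂ) * (e.weight (e.n - m) t₁ t₂ * e.f q) := by
    rw [← extend_borel_mul e (e.n - m) t₁ t₂ z q, ← h]
    rfl
  have h3 : (e.translate g m).exponent = e.exponent := rfl
  have h4 : (e.translate g m).n = m := rfl
  rw [h2, h3, h4, weight]
  have h5 : e.exponent (t₁ * t₂⁻¹) = (e.χ t₁ : ℂ) * (e.χ t₂ : ℂ)⁻¹ *
      (ideleNorm K (t₁ * t₂⁻¹) : ℂ) ^ (1 / 2 + e.α) := by
    rw [exponent, quasiCharacter, map_mul, map_inv, Circle.coe_mul, Circle.coe_inv]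
  rw [← exponent_mul, h5]
  ring

/-- The sum of both endpoint values bounds the power whatever the sign of `s`, as needed for `s =
-M` with `M` arbitrary. -/
theorem rpow_le_add_of_le_of_le {c C t : ℝ} (hc : 0 < c) (h1 : c ≤ t) (h2 : t ≤ C) (s : ℝ) :
    t ^ s ≤ c ^ s + C ^ s := by
  have ht := hc.trans_le h1
  rcases le_total 0 s with hs | hs
  · exact (Real.rpow_le_rpow ht.le h2 hs).trans
      (le_add_of_nonneg_left (Real.rpow_nonneg hc.le _))
  · exact (Real.rpow_le_rpow_of_nonpos hc h1 hs).trans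
      (le_add_of_nonneg_right (Real.rpow_nonneg (ht.le.trans h2) _))

theorem IsExpansionOn.rightTranslate {φ : GL (Fin 2) 𝔸[K] → ℂ}
    (hφ : ∀ (u : 𝔸[K]ˣ) (g : GL (Fin 2) 𝔸[K]), φ (zMat u * g) = (ω u : ℂ) * φ g)
    {ι : Type*} [Fintype ι] {e : ι → ExpTerm ω} (he : IsExpansionOn φ e)
    (g : GL (Fin 2) 𝔸[K]) :
    IsExpansionOn (rightTranslate g φ)
      fun p : Σ i, Fin ((e i).n + 1) => (e p.1).translate g p.2 := by
  intro M
  obtain ⟨C, T, hC⟩ := he M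
  obtain ⟨c, hc, hlo⟩ := exists_le_ideleNorm_div g
  obtain ⟨D, hhi⟩ := exists_ideleNorm_div_le g
  -- Since `|τ| ≥ c`, this threshold forces `|y τ| ≥ T`; the constant absorbs `|τ|^{-M}`.
  refine ⟨|C| * (c ^ (-M) + D ^ (-M)), max T 0 / c, fun x y k hy => ?_⟩
  obtain ⟨t₁, t₂, z, q, h⟩ := exists_iwasawa (k.1 * g)
  have h1 := hlo _ _ _ _ _ h
  have h2 := hhi _ _ _ _ _ h
  set τ := t₁ * t₂⁻¹ with hτ
  have hT : T ≤ ideleNorm K (y * τ) := by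
    rw [ideleNorm_mul]
    refine (le_max_left T 0).trans (((div_le_iff₀ hc).1 hy).trans ?_)
    exact mul_le_mul_of_nonneg_left h1 (ideleNorm_pos y).le
  have hval : FinReg.rightTranslate g φ (nMat x * aMat y * k.1) =
      (ω t₂ : ℂ) * φ (nMat ((y * z + x * t₂) * ↑t₂⁻¹) * aMat (y * τ) * q.1) := by
    rw [FinReg.rightTranslate, mul_assoc, h, ← mul_assoc, nMat_mul_aMat_mul_borel, mul_assoc, hφ]
  rw [hval, Fintype.sum_sigma]
  simp only [ExpTerm.sum_translate_value _ h]
  rw [← Finset.mul_sum, ← mul_sub, norm_mul, Circle.norm_coe, one_mul]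
  refine (hC _ (y * τ) q hT).trans ?_
  rw [ideleNorm_mul, Real.mul_rpow (ideleNorm_pos _).le (ideleNorm_pos _).le, mul_assoc]
  refine mul_le_mul (le_abs_self C) ?_
    (mul_nonneg (Real.rpow_nonneg (ideleNorm_pos _).le _)
      (Real.rpow_nonneg (ideleNorm_pos _).le _)) (abs_nonneg C)
  rw [mul_comm]
  exact mul_le_mul_of_nonneg_right (rpow_le_add_of_le_of_le hc h1 h2 _)
    (Real.rpow_nonneg (ideleNorm_pos _).le _)

/-! ## Reduction of expansions -/

open scoped Classical in
theorem IsSmoothOnCompact.add {f f' : maxCompact K → ℂ} (hf : IsSmoothOnCompact f)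
    (hf' : IsSmoothOnCompact f') : IsSmoothOnCompact (f + f') := by
  obtain ⟨⟨U, hU, h1⟩, h2⟩ := hf
  obtain ⟨⟨V, hV, h3⟩, h4⟩ := hf'
  refine ⟨⟨U ⊓ V, hU.inter hV, fun k k' hk hk' => ?_⟩, fun k₀ => ?_⟩
  · simp only [Pi.add_apply, h1 k k' hk hk'.1, h3 k k' hk hk'.2]
  · obtain ⟨Ω, F, hΩ, hΩ', hF, hF'⟩ := h2 k₀
    obtain ⟨Ω₂, G, hΩ₂, hΩ₂', hG, hG'⟩ := h4 k₀
    exact ⟨Ω ∩ Ω₂, F + G, hΩ.inter hΩ₂, fun h hh => ⟨hΩ' h hh, hΩ₂' h hh⟩,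
      (hF.mono Set.inter_subset_left).add (hG.mono Set.inter_subset_right),
      fun k hk => by simp only [Pi.add_apply, hF' k hk, hG' k hk]⟩

open scoped Classical in
theorem IsSmoothOnCompact.zero : IsSmoothOnCompact (0 : maxCompact K → ℂ) :=
  ⟨⟨⊤, by simp, fun _ _ _ _ => rfl⟩, fun _ => ⟨Set.univ, 0, isOpen_univ, fun _ _ => trivial,
    contDiffOn_const, fun _ _ => rfl⟩⟩

theorem IsSmoothOnCompact.sum {ι : Type*} (s : Finset ι) {f : ι → maxCompact K → ℂ}
    (hf : ∀ i ∈ s, IsSmoothOnCompact (f i)) : IsSmoothOnCompact (∑ i ∈ s, f i) :=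
  Finset.sum_induction f IsSmoothOnCompact (fun _ _ => IsSmoothOnCompact.add)
    IsSmoothOnCompact.zero hf

/-- Equal exponents need not have equal `χ`, since an imaginary power of the norm may move into `χ`.
On ideles of norm `1` the characters agree, and the induction law sees only those. -/
theorem ExpTerm.induced_of_exponent_eq {e d : ExpTerm ω} (h : e.exponent = d.exponent) :
    IsInduced ω d.χ e.f := by
  intro t₁ t₂ x hb k
  obtain ⟨h1, h2⟩ := ideleNorm_eq_one_of_borel_mem hb
  have key (t : 𝔸[K]ˣ) (ht : ideleNorm K t = 1) : (e.χ t : ℂ) = d.χ t := by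
    simpa [exponent, quasiCharacter, ht] using congr_fun h t
  rw [e.induced t₁ t₂ x hb k, key t₁ h1, key t₂ h2]

/-- The sum of summands with the same exponent as a given one. -/
def ExpTerm.collect {ι : Type*} (e : ι → ExpTerm ω) (d : ExpTerm ω) (s : Finset ι)
    (hs : ∀ i ∈ s, (e i).exponent = d.exponent) : ExpTerm ω where
  χ := d.χ
  α := d.α
  n := d.n
  f := ∑ i ∈ s, (e i).f
  smooth := IsSmoothOnCompact.sum s fun i _ => (e i).smooth
  induced := fun t₁ t₂ x hb k => by
    simp only [Finset.sum_apply, Finset.mul_sum]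
    exact Finset.sum_congr rfl fun i hi => induced_of_exponent_eq (hs i hi) t₁ t₂ x hb k

open scoped Classical in
-- Terms are grouped by exponent and log power, and groups with zero total coefficient are dropped.
-- The last clause detects which exponents survive.
theorem IsExpansionOn.exists_isReduced {ι : Type*} [Fintype ι] {φ : GL (Fin 2) 𝔸[K] → ℂ}
    {e : ι → ExpTerm ω} (he : IsExpansionOn φ e) :
    ∃ (l : ℕ) (d : Fin l → ExpTerm ω), IsExpansion φ d ∧ IsReduced d ∧
      ∀ i, ∑ j with ((e j).exponent, (e j).n) = ((e i).exponent, (e i).n), (e j).f ≠ 0 →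
        ∃ i', (d i').exponent = (e i).exponent := by
  let key (i : ι) : (𝔸[K]ˣ → ℂ) × ℕ := ((e i).exponent, (e i).n)
  let coeff (p : (𝔸[K]ˣ → ℂ) × ℕ) : maxCompact K → ℂ := ∑ j with key j = p, (e j).f
  let P : Finset ((𝔸[K]ˣ → ℂ) × ℕ) := (Finset.univ.image key).filter fun p => coeff p ≠ 0
  have hrep (p : P) : ∃ i, key i = p.1 := by
    simpa using (Finset.mem_filter.1 p.2).1
  choose rep hrep using hrep
  have hmem (p : P) : ∀ j ∈ Finset.univ.filter (fun j => key j = p.1),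
      (e j).exponent = (e (rep p)).exponent := fun j hj =>
    congrArg Prod.fst ((Finset.mem_filter.1 hj).2.trans (hrep p).symm)
  let d (p : P) : ExpTerm ω := ExpTerm.collect e (e (rep p)) _ (hmem p)
  have hd (p : P) : ((d p).exponent, (d p).n) = p.1 := hrep p
  have hexp : IsExpansionOn φ d := by
    refine he.of_sum_eq fun y k => ?_
    let term (p : (𝔸[K]ˣ → ℂ) × ℕ) : ℂ :=
      p.1 y * (Real.log (ideleNorm K y) : ℂ) ^ p.2 * coeff p k
    have h1 (p : P) : (d p).value y k = term p.1 := by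
      change (d p).exponent y * (Real.log (ideleNorm K y) : ℂ) ^ (d p).n * coeff p.1 k = _
      rw [show (d p).exponent = p.1.1 from congrArg Prod.fst (hd p),
        show (d p).n = p.1.2 from congrArg Prod.snd (hd p)]
    simp only [h1]
    rw [Finset.sum_coe_sort P term, Finset.sum_filter_of_ne fun p _ hp => ?_]
    · rw [← Finset.sum_fiberwise_of_maps_to (t := Finset.univ.image key) (g := key)
        fun i _ => Finset.mem_image_of_mem key (Finset.mem_univ i)]
      refine Finset.sum_congr rfl fun p _ => ?_
      simp only [term, coeff, Finset.sum_apply, Finset.mul_sum]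
      refine Finset.sum_congr rfl fun j hj => ?_
      rw [← (Finset.mem_filter.1 hj).2]
      rfl
    · rintro h0
      exact hp (by simp only [term, h0, Pi.zero_apply, mul_zero])
  let ε := Fintype.equivFin P
  refine ⟨Fintype.card P, d ∘ ε.symm, hexp.of_sum_eq fun y k => ?_, ⟨?_, fun i => ?_⟩,
    fun i hi => ?_⟩
  · exact ε.symm.sum_comp fun p => (d p).value y k
  · intro i j hij
    apply ε.symm.injective
    apply Subtype.ext
    rw [← hd, ← hd]
    exact hij
  · exact (Finset.mem_filter.1 (ε.symm i).2).2
  · let p : P := ⟨key i, Finset.mem_filter.2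
      ⟨Finset.mem_image_of_mem key (Finset.mem_univ i), hi⟩⟩
    exact ⟨ε p, by
      rw [Function.comp_apply, Equiv.symm_apply_apply]
      exact congrArg Prod.fst (hd p)⟩

/-! ## The theorem -/

theorem IsFinReg.rightTranslate {φ : GL (Fin 2) 𝔸[K] → ℂ} (hφ : IsFinReg ω φ)
    (g : GL (Fin 2) 𝔸[K]) : IsFinReg ω (rightTranslate g φ) where
  smooth := hφ.smooth.rightTranslate g
  left_invariant := fun γ h => by
    simp only [FinReg.rightTranslate, mul_assoc, hφ.left_invariant]
  central := fun u h => by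
    simp only [FinReg.rightTranslate, mul_assoc, hφ.central]
  expansion := by
    obtain ⟨l, e, he⟩ := hφ.expansion
    obtain ⟨l', d, hd, -⟩ :=
      (IsExpansionOn.rightTranslate hφ.central (e := e) he g).exists_isReduced
    exact ⟨l', d, hd⟩

/-- The top coefficient involves no logarithm of `|t₁/t₂|`. If `f(k₀) ≠ 0`, take for `k` the compact
part of `k₀ g⁻¹`: then `k g` lies in `B(𝔸) k₀`. -/
theorem ExpTerm.translate_top_ne_zero (e : ExpTerm ω) (he : e.f ≠ 0) (g : GL (Fin 2) 𝔸[K]) :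
    (e.translate g e.n).f ≠ 0 := by
  obtain ⟨k₀, hk₀⟩ := Function.ne_iff.1 he
  obtain ⟨t₁, t₂, x, k, h⟩ := exists_iwasawa (k₀.1 * g⁻¹)
  have h1 : k.1 * g = borel t₁⁻¹ (-(↑t₁⁻¹ * x * ↑t₂⁻¹)) t₂⁻¹ * k₀.1 := by
    rw [← borel_inv, eq_inv_mul_iff_mul_eq, ← mul_assoc, ← h, inv_mul_cancel_right]
  refine Function.ne_iff.2 ⟨k, ?_⟩
  change (e.n.choose e.n : ℂ) * e.extend (e.n - e.n) (k.1 * g) ≠ 0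
  rw [h1, extend_borel_mul, Nat.choose_self, Nat.sub_self, Nat.cast_one, one_mul]
  exact mul_ne_zero (e.weight_zero_ne_zero _ _) hk₀

theorem exponentSet_subset_rightTranslate {φ : GL (Fin 2) 𝔸[K] → ℂ}
    (hφ : ∀ (u : 𝔸[K]ˣ) (g : GL (Fin 2) 𝔸[K]), φ (zMat u * g) = (ω u : ℂ) * φ g)
    (g : GL (Fin 2) 𝔸[K]) : exponentSet ω φ ⊆ exponentSet ω (rightTranslate g φ) := by
  classical
  rintro μ ⟨l, e, he, ⟨hinj, hne⟩, i₀, rfl⟩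
  -- Among the terms with the given exponent, take the one with the largest log power.
  obtain ⟨i, hi, hmax⟩ := Finset.exists_max_image
    (Finset.univ.filter fun j => (e j).exponent = (e i₀).exponent) (fun j => (e j).n)
    ⟨i₀, Finset.mem_filter.2 ⟨Finset.mem_univ _, rfl⟩⟩
  have hi' : (e i).exponent = (e i₀).exponent := (Finset.mem_filter.1 hi).2
  obtain ⟨l', d, hd, hred, h⟩ :=
    (IsExpansionOn.rightTranslate hφ (e := e) he g).exists_isReduced
  obtain ⟨i', hi''⟩ := h ⟨i, Fin.last _⟩ <| by
    rw [Finset.sum_eq_single (⟨i, Fin.last _⟩ : Σ i, Fin ((e i).n + 1))]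
    · exact (e i).translate_top_ne_zero (hne i) g
    · rintro ⟨j, m⟩ hj hjne
      exfalso
      -- A competing term comes from some `j` with the same exponent and `n_j ≥ n_i`. Maximality
      -- gives equality, and reducedness gives `j = i`, so nothing cancels.
      obtain ⟨hj1, hj2⟩ := Prod.ext_iff.1 (Finset.mem_filter.1 hj).2
      change (e j).exponent = (e i).exponent at hj1
      change (m : ℕ) = (e i).n at hj2
      have hjn := hmax j (Finset.mem_filter.2 ⟨Finset.mem_univ _, hj1.trans hi'⟩)
      have hmn := m.is_le
      obtain rfl : j = i := hinj (Prod.ext hj1 (by dsimp only; omega))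
      exact hjne (by rw [show m = Fin.last _ from Fin.ext hj2])
    · intro h
      exact (h (Finset.mem_filter.2 ⟨Finset.mem_univ _, rfl⟩)).elim
  exact ⟨l', d, hd, hred, i', by rw [hi'']; exact hi'.symm⟩

end FinReg

end

theorem mainTheorem6 (K : Type*) [Field K] [NumberField K] (ω : FinReg.HeckeCharacter K) :
    (∀ φ ∈ FinReg.finRegSpace ω, ∀ g : GL (Fin 2) (AdeleRing (𝓞 K) K),
      FinReg.rightTranslate g φ ∈ FinReg.finRegSpace ω) ∧
    (∀ φ ∈ FinReg.finRegSpace ω, ∀ g : GL (Fin 2) (AdeleRing (𝓞 K) K),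
      FinReg.exponentSet ω (FinReg.rightTranslate g φ) = FinReg.exponentSet ω φ) := by
  have h1 (φ) (hφ : φ ∈ FinReg.finRegSpace ω) (g : GL (Fin 2) (AdeleRing (𝓞 K) K)) :
      FinReg.rightTranslate g φ ∈ FinReg.finRegSpace ω :=
    FinReg.IsFinReg.rightTranslate hφ g
  refine ⟨h1, fun φ hφ g => Set.Subset.antisymm ?_ ?_⟩
  -- Translating `g.φ` back by `g⁻¹` turns the one-sided inclusion into equality.
  · have h2 := FinReg.exponentSet_subset_rightTranslate (h1 φ hφ g).central g⁻¹
    have h3 : FinReg.rightTranslate g⁻¹ (FinReg.rightTranslate g φ) = φ := funext fun x => by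
      simp only [FinReg.rightTranslate, inv_mul_cancel_right]
    rwa [h3] at h2
  · exact FinReg.exponentSet_subset_rightTranslate hφ.central g
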